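/- **Setting.** Let $d\ge 1$, $I_\pm=\{\pm1,\dots,\pm d\}$, let $r:I_\pm\to\mathbb Z^d$ be a jump function with mean $\overline r=\frac1{2d}\sum_{\tau\in I_\pm} r(\tau)$, and let $C(\omega)$ be a random unitary matrix on $\mathbb C^{2d}$ (with canonical basis $\{|\tau\rangle\}_{\tau\in I_\pm}$ and projectors $P_\tau=|\tau\rangle\langle\tau|$) defined on a probability space $(\Omega,\mu)$. For $\overline\omega=(\omega_1,\omega_2,\dots)$ distributed according to $\mathbb P=\mu^{\otimes\mathbb N^*}$, with expectation denoted by $\mathbb E_\omega$, consider on $\mathbb C^{2d}\otimes\ell^2(\mathbb Z^d)$ the quantum walk $U_{\overline\omega}(n,0)=U_n\cdots U_1$, $U_s=\sum_{x\in\mathbb Z^d}\sum_{\tau\in I_\pm}P_\tau C(\omega_s)\otimes|x+r(\tau)\rangle\langle x|$. Let the initial state be $\Psi_0=\varphi_0\otimes|0\rangle$ with $\|\varphi_0\|=1$, let $W^\omega_k(n)=\|(U_{\overline\omega}(n,0)\Psi_0)(k)\|^2$ for $k\in\mathbb Z^d$, and let $X_n^\omega$ be a random vector in $\mathbb Z^d$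 with law $W^\omega(n)$. For $z\in\mathbb R^d\setminus\{0\}$ put $$Y_n^\omega=\frac{X_n^\omega-n\overline r}{\sqrt n},\qquad D_n^\omega=\langle z|Y_n^\omega\rangle\langle Y_n^\omega|z\rangle .$$ Let $\mathcal E=\int_\Omega C(\omega)\otimes\overline{C(\omega)}\,d\mu(\omega)$, acting on $\mathbb C^{2d}\otimes\mathbb C^{2d}$, let $D(y,y')$ be the diagonal matrix with entries $e^{i(y\cdot r(\tau)+y'\cdot r(\tau'))}$ in the basis $|\tau\otimes\tau'\rangle$, and let $\mathcal M(y,y')=D(y,y')\mathcal E$. **Assumption S.** For all $v\in\mathbb T^d=[0,2\pi)^d$, $\sigma(\mathcal M(-v,v))\cap\{|\lambda|=1\}=\{1\}$ and the eigenvalue $1$ is simple. Under Assumption S let $P$ be the orthogonal projector on the span of $\sum_\tau|\tau\otimes\tau\rangle$ (this is the spectral projector of $\mathcal M(-v,v)$ at $1$), let $Q=\mathbb I-P$, and let $S_v(1)$ be the reduced resolvent of $\mathcal M(-v,v)$ at $1$, that is, the inverse of $\mathcal M(-v,v)-1$ on the range of $Q$, and $0$ on the range of $P$. The diffusion matrix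 is $\mathbb D=\int_{[0,2\pi)^d}\mathbb D(v)\frac{dv}{(2\pi)^d}$, where $\mathbb D(v)$ is the symmetric matrix given, for $y\in\mathbb R^d$, by $$\langle y|\mathbb D(v)y\rangle=(y\cdot\overline r)^2-\frac1{2d}\sum_{\tau\in I_\pm}(y\cdot r(\tau))^2-\frac1d\sum_{\tau,\tau'\in I_\pm}(y\cdot r(\tau))(y\cdot r(\tau'))\,\langle\tau\otimes\tau|S_v(1)\,\tau'\otimes\tau'\rangle .$$ **Proposition.** Suppose Assumption S holds. (i) Let $z\in\mathbb R^d\setminus\{0\}$ and suppose that the random variables $\mathbb E_{W^\omega(n)}(D_n^\omega)$ converge in distribution, as $n\to\infty$, to a real random variable $D^\omega$ (possibly defined on another probability space). Then all $\mathbb E_{W^\omega(n)}(D_n^\omega)$ and $D^\omega$ are integrable, and $$\mathbb E_\omega(D^\omega)=\lim_{n\to\infty}\mathbb E_\omega\,\mathbb E_{W^\omega(n)}(D_n^\omega)=\langle z|\mathbb D z\rangle .$$ (ii) Consequently, if $\mathbb D^\omega$ is a random real matrix, almost surely symmetric, such that for every $z\in\mathbb R^d\setminus\{0\}$ the variables $\mathbb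 E_{W^\omega(n)}(D_n^\omega)$ converge in distribution to $D^\omega=\langle z|\mathbb D^\omega z\rangle$, then the entries of $\mathbb D^\omega$ are integrable and $\mathbb E_\omega(\mathbb D^\omega)=\mathbb D$. -/

import Mathlib

open MeasureTheory ProbabilityTheory Filter Topology
open scoped Kronecker

namespace RandomQuantumWalk

noncomputable section

/-- Internal labels `I_± = {±1, …, ±d}`: the pair `(j, ε)` stands for `ε (j + 1)`. -/
abbrev CoinIdx (d : ℕ) : Type := Fin d × ℤˣ

/-- The coin space `ℂ^{2d}`, with its Hermitian norm and basis indexed by `I_±`. -/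
abbrev CoinSpace (d : ℕ) : Type := EuclideanSpace ℂ (CoinIdx d)

/-- Wave functions `ψ : ℤ^d → ℂ^{2d}`. The states used below are finitely supported, hence lie
in `ℂ^{2d} ⊗ ℓ²(ℤ^d)`. -/
abbrev WaveFun (d : ℕ) : Type := (Fin d → ℤ) → CoinSpace d

/-- The localized state `φ ⊗ |0⟩`. -/
def localized {d : ℕ} (φ : CoinSpace d) : WaveFun d := fun x => if x = 0 then φ else 0

/-- One step `U = S (C ⊗ 1) = ∑_x ∑_τ P_τ C ⊗ |x + r(τ)⟩⟨x|`, that is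
`(U ψ)(x) = ∑_τ P_τ C ψ(x - r(τ))`. -/
def step {d : ℕ} (r : CoinIdx d → Fin d → ℤ) (C : Matrix (CoinIdx d) (CoinIdx d) ℂ)
    (ψ : WaveFun d) : WaveFun d :=
  fun x => ∑ τ, EuclideanSpace.single τ (C.mulVec (ψ (x - r τ)).ofLp τ)

/-- `U(n,0) ψ = U_n ⋯ U_1 ψ`, where the coin of the `s`-th step is `C (s - 1)`. -/
def evolve {d : ℕ} (r : CoinIdx d → Fin d → ℤ) (C : ℕ → Matrix (CoinIdx d) (CoinIdx d) ℂ)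
    (ψ : WaveFun d) : ℕ → WaveFun d
  | 0 => ψ
  | n + 1 => step r (C n) (evolve r C ψ n)

/-- `W_k(n)`, the probability of finding the walker at `k` at time `n`, started from
`φ₀ ⊗ |0⟩`. -/
def posProb {d : ℕ} (r : CoinIdx d → Fin d → ℤ) (C : ℕ → Matrix (CoinIdx d) (CoinIdx d) ℂ)
    (φ₀ : CoinSpace d) (n : ℕ) (k : Fin d → ℤ) : ℝ :=
  ‖evolve r C (localized φ₀) n k‖ ^ 2

/-- The mean jump `r̄ = (2d)⁻¹ ∑_τ r(τ)`. -/
def meanJump {d : ℕ} (r : CoinIdx d → Fin d → ℤ) : Fin d → ℝ :=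
  fun i => (2 * d : ℝ)⁻¹ * ∑ τ, (r τ i : ℝ)

/-- The rescaled centred position `(k - n r̄) / √n`. -/
def rescaled {d : ℕ} (r : CoinIdx d → Fin d → ℤ) (n : ℕ) (k : Fin d → ℤ) : Fin d → ℝ :=
  fun i => ((k i : ℝ) - n * meanJump r i) / √(n : ℝ)

/-- `𝔼_{W(n)}(D_n)` with `D_n = ⟨z|Y_n⟩⟨Y_n|z⟩`, `Y_n = (X_n - n r̄)/√n` and `X_n` of law `W(n)`.
The sum has finitely many nonzero terms. -/
def quadForm {d : ℕ} (r : CoinIdx d → Fin d → ℤ) (C : ℕ → Matrix (CoinIdx d) (CoinIdx d) ℂ)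
    (φ₀ : CoinSpace d) (z : Fin d → ℝ) (n : ℕ) : ℝ :=
  ∑' k : Fin d → ℤ, posProb r C φ₀ n k * ((z ⬝ᵥ rescaled r n k) * (rescaled r n k ⬝ᵥ z))

/-- The coin sequence `s ↦ C(ω_s)` attached to `ω̄ = (ω_s)_s`. -/
def coins {d : ℕ} {Ω : Type*} (C : Ω → Matrix.unitaryGroup (CoinIdx d) ℂ) (ω : ℕ → Ω) :
    ℕ → Matrix (CoinIdx d) (CoinIdx d) ℂ :=
  fun s => (C (ω s) : Matrix (CoinIdx d) (CoinIdx d) ℂ)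

/-- Matrices on `ℂ^{2d} ⊗ ℂ^{2d}` in the basis `|τ ⊗ τ'⟩`. -/
abbrev Mat2 (d : ℕ) : Type := Matrix (CoinIdx d × CoinIdx d) (CoinIdx d × CoinIdx d) ℂ

/-- `ℰ = 𝔼(C(ω) ⊗ \overline{C(ω)})`, entrywise. -/
def meanTensor {d : ℕ} {Ω : Type*} [MeasurableSpace Ω] (μ : Measure Ω)
    (C : Ω → Matrix.unitaryGroup (CoinIdx d) ℂ) : Mat2 d :=
  fun S T => ∫ ω, ((C ω : Matrix (CoinIdx d) (CoinIdx d) ℂ) ⊗ₖ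
    (C ω : Matrix (CoinIdx d) (CoinIdx d) ℂ).map (starRingEnd ℂ)) S T ∂μ

/-- The diagonal matrix `D(y,y')` with entries `exp(i(y·r(τ) + y'·r(τ')))`. -/
def phaseMat {d : ℕ} (r : CoinIdx d → Fin d → ℤ) (y y' : Fin d → ℝ) : Mat2 d :=
  Matrix.diagonal fun T => Complex.exp
    (Complex.I * ((∑ i, (y i * r T.1 i + y' i * r T.2 i) : ℝ) : ℂ))

/-- `ℳ(y,y') = D(y,y') ℰ`. -/
def meanMat {d : ℕ} {Ω : Type*} [MeasurableSpace Ω] (r : CoinIdx d → Fin d → ℤ) (μ : Measure Ω)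
    (C : Ω → Matrix.unitaryGroup (CoinIdx d) ℂ) (y y' : Fin d → ℝ) : Mat2 d :=
  phaseMat r y y' * meanTensor μ C

/-- Assumption S: for every `v`, the only eigenvalue of `ℳ(-v,v)` on the unit circle is `1`,
and it is (algebraically) simple. -/
def AssumptionS {d : ℕ} {Ω : Type*} [MeasurableSpace Ω] (r : CoinIdx d → Fin d → ℤ)
    (μ : Measure Ω) (C : Ω → Matrix.unitaryGroup (CoinIdx d) ℂ) : Prop :=
  ∀ v : Fin d → ℝ,
    spectrum ℂ (meanMat r μ C (-v) v) ∩ Metric.sphere (0 : ℂ) 1 = {1} ∧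
    (meanMat r μ C (-v) v).charpoly.rootMultiplicity 1 = 1

/-- `Ψ₁ = ∑_τ |τ ⊗ τ⟩`. -/
def psiOne (d : ℕ) : CoinIdx d × CoinIdx d → ℂ := fun T => if T.1 = T.2 then 1 else 0

/-- The projector `P = |Ψ₀⟩⟨Ψ₀|`, where `Ψ₀ = Ψ₁/‖Ψ₁‖` and `‖Ψ₁‖² = 2d`. -/
def projP (d : ℕ) : Mat2 d :=
  (2 * d : ℂ)⁻¹ • Matrix.vecMulVec (psiOne d) (star (psiOne d))

/-- The reduced resolvent `S_v(1)` of `ℳ(-v,v)` at the eigenvalue `1`: the inverse of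
`ℳ(-v,v) - 1` on the range of `Q = 1 - P`, and `0` on the range of `P`. Since
`ℳ(-v,v) = P + Q ℳ(-v,v) Q`, one has `(ℳ(-v,v) - Q)⁻¹ = P + S_v(1)`. -/
def reducedResolvent {d : ℕ} {Ω : Type*} [MeasurableSpace Ω] (r : CoinIdx d → Fin d → ℤ)
    (μ : Measure Ω) (C : Ω → Matrix.unitaryGroup (CoinIdx d) ℂ) (v : Fin d → ℝ) : Mat2 d :=
  (meanMat r μ C (-v) v - (1 - projP d))⁻¹ - projP d

/-- The diffusion matrix at `v`: the symmetric matrix `𝔻(v)` with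
`⟨y|𝔻(v)y⟩ = (y·r̄)² - (2d)⁻¹ ∑_τ (y·r(τ))²
  - d⁻¹ ∑_{τ,τ'} (y·r(τ)) (y·r(τ')) ⟨τ⊗τ|S_v(1)|τ'⊗τ'⟩`.
Equivalently, `log λ₁(y,v) = i y·r̄ - ⟨y|𝔻(v)y⟩/2 + O(|y|³)` for the eigenvalue `λ₁(y,v)` of
`ℳ(y-v,v)` close to `1`. -/
def diffusionAt {d : ℕ} {Ω : Type*} [MeasurableSpace Ω] (r : CoinIdx d → Fin d → ℤ)
    (μ : Measure Ω) (C : Ω → Matrix.unitaryGroup (CoinIdx d) ℂ) (v : Fin d → ℝ) :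
    Matrix (Fin d) (Fin d) ℂ :=
  fun i j => (meanJump r i * meanJump r j : ℂ)
    - (2 * d : ℂ)⁻¹ * ∑ τ, (r τ i : ℂ) * (r τ j : ℂ)
    - (2 * d : ℂ)⁻¹ * ∑ τ, ∑ τ', ((r τ i : ℂ) * (r τ' j : ℂ) + (r τ j : ℂ) * (r τ' i : ℂ)) *
        reducedResolvent r μ C v (τ, τ) (τ', τ')

/-- The averaged diffusion matrix `𝔻 = (2π)^{-d} ∫_{[0,2π)^d} 𝔻(v) dv`. -/
def diffusion {d : ℕ} {Ω : Type*} [MeasurableSpace Ω] (r : CoinIdx d → Fin d → ℤ)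
    (μ : Measure Ω) (C : Ω → Matrix.unitaryGroup (CoinIdx d) ℂ) : Matrix (Fin d) (Fin d) ℂ :=
  fun i j => ((2 * Real.pi : ℂ) ^ d)⁻¹ *
    ∫ v in Set.univ.pi (fun _ : Fin d => Set.Ico (0 : ℝ) (2 * Real.pi)), diffusionAt r μ C v i j

end

end RandomQuantumWalk

/-! The averaged process is governed by the family of matrices `ℳ(-v,v)`. Since the coins are
independent, the two-point function `𝔼 (ψ_n(x) ⊗ conj ψ_n(x'))` obeys a linear recursion driven by
`ℰ` (`twoPoint_succ`). Its Fourier transform at `(-v,v)`, weighted by the `m`-th power of the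
centred displacement along `z`, is a vector `u m n` with `u m (n+1) = ∑ j, (m choose j) A^j M u
(m-j) n`. Here `M = ℳ(-v,v)` and `A` multiplies by the centred jump (`isMomentSeq_momentVec`).

With `e = Ψ₁/2d` and `ℓ` the trace form, unitarity of the coins gives `M e = e` and `ℓ ∘ M = ℓ`, and
centring gives `ℓ (A e) = 0`. Assumption S makes `M - e ⊗ ℓ` a contraction up to a power, uniformly
over a period in `v`. Write `u = ℓ(u) e + w`. The remainder `w` grows no faster than its forcing,
and in the leading increment of `ℓ(u)` only `w` survives. Hence `ℓ(u 2 n) = O(n)` and `ℓ(u 4 n) =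
O(n²)` (`IsMomentSeq.growth`), and `ℓ(u 2 n)/n` converges to a resolvent expression
(`IsMomentSeq.tendsto_second`), which is `⟨z|𝔻(v)z⟩` (`AssumptionS.limit_eq_diffusionAt`).

Integrating over `v` selects `x = x'` and recovers the position moments. Dominated convergence gives
the limit of the averaged `quadForm`. By Cauchy–Schwarz the fourth moment bounds the second moment
of `quadForm`, so convergence in distribution carries the means along
(`tendsto_integral_of_tendstoInDistribution`). Part (ii) is polarization. -/

namespace RandomQuantumWalk

/-! ### Affine recursions driven by an eventually contracting operator. -/

section Recursion

variable {ι E F : Type*} [NormedAddCommGroup E] [NormedSpace ℂ E]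
  [NormedAddCommGroup F] [NormedSpace ℂ F]

/-- If `T` is a contraction with `‖T ^ N‖ ≤ 1/2`, then solutions of `w (n+1) = T (w n) + f n` grow
at most like the forcing `f`. -/
lemma norm_le_of_affine_recursion {T : E →L[ℂ] E} {N : ℕ} (hN : 1 ≤ N)
    (hTN : ‖T ^ N‖ ≤ 1 / 2) (hT : ‖T‖ ≤ 1) {w f : ℕ → E} {c : ℝ} {k : ℕ} (h0 : ‖w 0‖ ≤ c)
    (hw : ∀ n, w (n + 1) = T (w n) + f n) (hf : ∀ n, ‖f n‖ ≤ c * ((n : ℝ) + 1) ^ k) (n : ℕ) :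
    ‖w n‖ ≤ 2 * (N : ℝ) ^ 2 * c * ((n : ℝ) + 1) ^ k := by
  have hc : 0 ≤ c := (norm_nonneg _).trans h0
  have hN' : (1 : ℝ) ≤ N := by exact_mod_cast hN
  -- `Λ` is an equivalent norm in which `T` itself contracts, by the factor `1 - 1/(2N)`:
  -- telescoping gives `Λ (T a) = Λ a - ‖a‖ + ‖T^N a‖ ≤ Λ a - ‖a‖/2`, and `‖a‖ ≥ Λ a / N`. A forcing
  -- with `Λ f ≤ N c X` is then balanced at the level `2N · N c X`, whence the constant `2N²c`.
  set Λ : E → ℝ := fun a => ∑ i ∈ Finset.range N, ‖(T ^ i) a‖ with hΛ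
  have Λ_add : ∀ a b, Λ (a + b) ≤ Λ a + Λ b := fun a b => by
    simp only [hΛ, map_add, ← Finset.sum_add_distrib]
    exact Finset.sum_le_sum fun i _ => norm_add_le _ _
  have Λ_le : ∀ a, Λ a ≤ N * ‖a‖ := fun a => by
    calc Λ a ≤ ∑ i ∈ Finset.range N, ‖a‖ := Finset.sum_le_sum fun i _ => by
          refine ((T ^ i).le_opNorm a).trans (mul_le_of_le_one_left (norm_nonneg _) ?_)
          rcases Nat.eq_zero_or_pos i with rfl | hi
          · exact ContinuousLinearMap.norm_id_le
          · exact (norm_pow_le' T hi).trans (pow_le_one₀ (norm_nonneg _) hT)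
      _ = N * ‖a‖ := by simp
  have le_Λ : ∀ a, ‖a‖ ≤ Λ a := fun a => by
    have := Finset.single_le_sum (f := fun i => ‖(T ^ i) a‖) (fun i _ => norm_nonneg _)
      (Finset.mem_range.2 hN)
    simpa only [pow_zero, one_apply_eq_self] using this
  have Λ_map : ∀ a, 2 * N * Λ (T a) ≤ (2 * N - 1) * Λ a := fun a => by
    have h1 : Λ (T a) + ‖a‖ = Λ a + ‖(T ^ N) a‖ := by
      have e1 := Finset.sum_range_succ (fun i => ‖(T ^ i) a‖) N
      have e2 := Finset.sum_range_succ' (fun i => ‖(T ^ i) a‖) N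
      simp only [pow_zero, pow_succ, mul_apply_eq_comp, one_apply_eq_self] at e1 e2
      simp only [hΛ]
      linarith
    have h2 : ‖(T ^ N) a‖ ≤ 1 / 2 * ‖a‖ :=
      ((T ^ N).le_opNorm a).trans (mul_le_mul_of_nonneg_right hTN (norm_nonneg _))
    have h3 := Λ_le a
    nlinarith
  have key : ∀ n, Λ (w n) ≤ 2 * (N : ℝ) ^ 2 * c * ((n : ℝ) + 1) ^ k := by
    intro n
    induction n with
    | zero =>
      have := (Λ_le (w 0)).trans (mul_le_mul_of_nonneg_left h0 (by positivity : (0 : ℝ) ≤ N))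
      simp only [Nat.cast_zero, zero_add, one_pow, mul_one]
      nlinarith [mul_nonneg hc (by linarith : (0 : ℝ) ≤ N - 1), mul_nonneg hc (sq_nonneg (N : ℝ))]
    | succ n ih =>
      have h1 := Λ_add (T (w n)) (f n)
      rw [← hw] at h1
      have h2 := Λ_map (w n)
      have h3 := (Λ_le (f n)).trans
        (mul_le_mul_of_nonneg_left (hf n) (by positivity : (0 : ℝ) ≤ N))
      have h4 : ((n : ℝ) + 1) ^ k ≤ ((n + 1 : ℕ) + 1 : ℝ) ^ k := by
        push_cast
        gcongr
        linarith
      refine le_trans ?_ (mul_le_mul_of_nonneg_left h4 (by positivity))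
      set X := ((n : ℝ) + 1) ^ k
      have h5 : (2 * N - 1 : ℝ) * Λ (w n) ≤ (2 * N - 1) * (2 * (N : ℝ) ^ 2 * c * X) :=
        mul_le_mul_of_nonneg_left ih (by linarith)
      have h6 : (2 * N : ℝ) * Λ (w (n + 1)) ≤ (2 * N) * (2 * (N : ℝ) ^ 2 * c * X) := by
        have := mul_le_mul_of_nonneg_left h1 (by positivity : (0 : ℝ) ≤ 2 * N)
        have := mul_le_mul_of_nonneg_left h3 (by positivity : (0 : ℝ) ≤ 2 * N)
        nlinarith
      exact le_of_mul_le_mul_left h6 (by positivity)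
  exact (le_Λ _).trans (key n)

/-- `g i n = O(n ^ k)`, uniformly in the parameter `i`. -/
def Growth (k : ℕ) (g : ι → ℕ → E) : Prop := ∃ c : ℝ, ∀ i n, ‖g i n‖ ≤ c * ((n : ℝ) + 1) ^ k

omit [NormedSpace ℂ E] in
lemma Growth.exists_nonneg {k : ℕ} {g : ι → ℕ → E} (h : Growth k g) :
    ∃ c : ℝ, 0 ≤ c ∧ ∀ i n, ‖g i n‖ ≤ c * ((n : ℝ) + 1) ^ k := by
  obtain ⟨c, hc⟩ := h
  exact ⟨max c 0, le_max_right _ _, fun i n => (hc i n).trans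
    (mul_le_mul_of_nonneg_right (le_max_left _ _) (by positivity))⟩

omit [NormedSpace ℂ E] in
lemma Growth.mono {k l : ℕ} {g : ι → ℕ → E} (h : Growth k g) (hkl : k ≤ l) : Growth l g := by
  obtain ⟨c, hc0, hc⟩ := h.exists_nonneg
  refine ⟨c, fun i n => (hc i n).trans (mul_le_mul_of_nonneg_left ?_ hc0)⟩
  exact pow_le_pow_right₀ (by linarith [n.cast_nonneg (α := ℝ)]) hkl

omit [NormedSpace ℂ E] in
lemma Growth.add {k : ℕ} {g h : ι → ℕ → E} (hg : Growth k g) (hh : Growth k h) :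
    Growth k fun i n => g i n + h i n := by
  obtain ⟨c, hc⟩ := hg
  obtain ⟨c', hc'⟩ := hh
  exact ⟨c + c', fun i n => (norm_add_le _ _).trans (by linarith [hc i n, hc' i n])⟩

lemma Growth.clm {k : ℕ} {g : ι → ℕ → E} (hg : Growth k g) {L : ι → E →L[ℂ] F} {K : ℝ}
    (hL : ∀ i, ‖L i‖ ≤ K) : Growth k fun i n => L i (g i n) := by
  obtain ⟨c, hc0, hc⟩ := hg.exists_nonneg
  refine ⟨K * c, fun i n => ((L i).le_opNorm _).trans ?_⟩
  rw [mul_assoc]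
  exact mul_le_mul (hL i) (hc i n) (norm_nonneg _) ((norm_nonneg _).trans (hL i))

lemma Growth.map {k : ℕ} {g : ι → ℕ → E} (hg : Growth k g) (L : E →L[ℂ] F) :
    Growth k fun i n => L (g i n) :=
  hg.clm (L := fun _ => L) fun _ => le_rfl

lemma Growth.const_smul {k : ℕ} {g : ι → ℕ → E} (hg : Growth k g) (a : ℂ) :
    Growth k fun i n => a • g i n :=
  hg.map (a • ContinuousLinearMap.id ℂ E)

lemma Growth.sub {k : ℕ} {g h : ι → ℕ → E} (hg : Growth k g) (hh : Growth k h) :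
    Growth k fun i n => g i n - h i n := by
  simpa [sub_eq_add_neg] using hg.add (hh.const_smul (-1))

lemma Growth.smul_const {k : ℕ} {p : ι → ℕ → ℂ} (hp : Growth k p) (e : E) :
    Growth k fun i n => p i n • e :=
  hp.map (ContinuousLinearMap.toSpanSingleton ℂ e)

lemma Growth.of_affine_recursion {T : ι → E →L[ℂ] E} {N : ℕ} (hN : 1 ≤ N)
    (hTN : ∀ i, ‖T i ^ N‖ ≤ 1 / 2) (hT : ∀ i, ‖T i‖ ≤ 1) {w f : ι → ℕ → E} {k : ℕ} {K : ℝ}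
    (h0 : ∀ i, ‖w i 0‖ ≤ K) (hw : ∀ i n, w i (n + 1) = T i (w i n) + f i n) (hf : Growth k f) :
    Growth k w := by
  obtain ⟨c, hc⟩ := hf
  refine ⟨2 * (N : ℝ) ^ 2 * max c K, fun i n => ?_⟩
  exact norm_le_of_affine_recursion hN (hTN i) (hT i) ((h0 i).trans (le_max_right _ _)) (hw i)
    (fun m => (hc i m).trans (mul_le_mul_of_nonneg_right (le_max_left _ _) (by positivity))) n

omit [NormedSpace ℂ E] in
lemma Growth.of_increment {p f : ι → ℕ → E} {k : ℕ} {K : ℝ} (h0 : ∀ i, ‖p i 0‖ ≤ K)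
    (hp : ∀ i n, p i (n + 1) = p i n + f i n) (hf : Growth k f) : Growth (k + 1) p := by
  obtain ⟨c, hc0, hc⟩ := hf.exists_nonneg
  refine ⟨max K c, fun i n => ?_⟩
  induction n with
  | zero => simpa using Or.inl (h0 i)
  | succ n ih =>
    rw [hp]
    refine (norm_add_le _ _).trans ((add_le_add ih (hc i n)).trans ?_)
    have h1 : ((n : ℝ) + 1) ^ k ≤ ((n : ℝ) + 1 + 1) ^ k := by gcongr; linarith
    have h2 : c * ((n : ℝ) + 1) ^ k ≤ max K c * ((n : ℝ) + 1) ^ k :=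
      mul_le_mul_of_nonneg_right (le_max_right _ _) (by positivity)
    have h3 : 0 ≤ max K c := hc0.trans (le_max_right _ _)
    push_cast
    have h4 := mul_le_mul_of_nonneg_left h1 (by positivity : 0 ≤ max K c * ((n : ℝ) + 1 + 1))
    rw [pow_succ, pow_succ]
    nlinarith

/-- The Cesàro means of a bounded solution of `w (n+1) = T (w n) + f n` converge if those of `f`
do. -/
lemma tendsto_cesaro_of_affine_recursion {T R : E →L[ℂ] E} (hR : ∀ x, R (x - T x) = x)
    {w f : ℕ → E} (hw : ∀ n, w (n + 1) = T (w n) + f n) {c : ℝ} (hc : ∀ n, ‖w n‖ ≤ c) {a : E}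
    (hf : Tendsto (fun n : ℕ => (n : ℂ)⁻¹ • ∑ j ∈ Finset.range n, f j) atTop (𝓝 a)) :
    Tendsto (fun n : ℕ => (n : ℂ)⁻¹ • ∑ j ∈ Finset.range n, w j) atTop (𝓝 (R a)) := by
  -- Summing the recursion gives `(1 - T) ∑ w = ∑ f - (w n - w 0)`, and `R` inverts `1 - T` on the
  -- left. The boundary term is bounded, so it disappears after division by `n`.
  have h1 : ∀ n, ∑ j ∈ Finset.range n, w j = R (∑ j ∈ Finset.range n, f j - (w n - w 0)) := by
    intro n
    have : ∑ j ∈ Finset.range n, f j - (w n - w 0)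
        = ∑ j ∈ Finset.range n, w j - T (∑ j ∈ Finset.range n, w j) := by
      rw [← Finset.sum_range_sub, ← Finset.sum_sub_distrib, map_sum, ← Finset.sum_sub_distrib]
      refine Finset.sum_congr rfl fun j _ => ?_
      rw [hw]; abel
    rw [this, hR]
  have h2 : Tendsto (fun n : ℕ => (n : ℂ)⁻¹ • (w n - w 0)) atTop (𝓝 0) := by
    refine squeeze_zero_norm (a := fun n : ℕ => (n : ℝ)⁻¹ * (c + c)) (fun n => ?_) ?_
    · rw [norm_smul, norm_inv, Complex.norm_natCast]
      gcongr
      exact (norm_sub_le _ _).trans (add_le_add (hc n) (hc 0))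
    · simpa using (tendsto_inv_atTop_zero.comp tendsto_natCast_atTop_atTop).mul_const (c + c)
  have h3 := (R.continuous.tendsto _).comp (hf.sub h2)
  simp only [sub_zero] at h3
  refine h3.congr fun n => ?_
  simp [h1, smul_sub]

end Recursion

/-! ### The abstract moment hierarchy: growth and diffusive limit. -/

section Moments

variable {ι E : Type*} [NormedAddCommGroup E] [NormedSpace ℂ E]

/-- `u m n` are the moments of order `m` at time `n` of the walk with transfer operator `M` and
infinitesimal translation `A`. -/
def IsMomentSeq (A M : E →L[ℂ] E) (u : ℕ → ℕ → E) : Prop :=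
  ∀ m n, u m (n + 1) = ∑ j ∈ Finset.range (m + 1), (m.choose j : ℂ) • (A ^ j) (M (u (m - j) n))

/-- The part of `M` complementary to the rank one projection `e ⊗ ℓ`. -/
noncomputable def deflate (ℓ : E →L[ℂ] ℂ) (e : E) (M : E →L[ℂ] E) : E →L[ℂ] E :=
  M - ℓ.smulRight e

lemma deflate_apply (ℓ : E →L[ℂ] ℂ) (e : E) (M : E →L[ℂ] E) (x : E) :
    deflate ℓ e M x = M x - ℓ x • e := rfl

/-- The projection `e ⊗ ℓ` commutes with `M`, and `deflate ℓ e M` kills `e`, so the component in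
`ker ℓ` evolves without feedback from `ℓ (u n)`. -/
lemma remainder_succ {ℓ : E →L[ℂ] ℂ} {e : E} {M : E →L[ℂ] E} (hℓe : ℓ e = 1) (hMe : M e = e)
    (hℓM : ∀ x, ℓ (M x) = ℓ x) {u f : ℕ → E} (hu : ∀ n, u (n + 1) = M (u n) + f n) (n : ℕ) :
    u (n + 1) - ℓ (u (n + 1)) • e
      = deflate ℓ e M (u n - ℓ (u n) • e) + (f n - ℓ (f n) • e) := by
  simp only [deflate_apply, hu, map_add, map_sub, map_smul, hℓM, hMe, hℓe]
  module

lemma Growth.remainder {ℓ : E →L[ℂ] ℂ} {e : E} {M : ι → E →L[ℂ] E} (hℓe : ℓ e = 1)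
    (hMe : ∀ i, M i e = e) (hℓM : ∀ i x, ℓ (M i x) = ℓ x) {N : ℕ} (hN : 1 ≤ N)
    (hTN : ∀ i, ‖deflate ℓ e (M i) ^ N‖ ≤ 1 / 2) (hT : ∀ i, ‖deflate ℓ e (M i)‖ ≤ 1)
    {u f : ι → ℕ → E} {k : ℕ} {K : ℝ} (h0 : ∀ i, ‖u i 0‖ ≤ K)
    (hu : ∀ i n, u i (n + 1) = M i (u i n) + f i n) (hf : Growth k f) :
    Growth k fun i n => u i n - ℓ (u i n) • e := by
  refine Growth.of_affine_recursion hN hTN hT (K := K + ‖ℓ‖ * K * ‖e‖) (fun i => ?_)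
    (fun i => remainder_succ hℓe (hMe i) (hℓM i) (hu i)) (hf.sub ((hf.map ℓ).smul_const e))
  refine (norm_sub_le _ _).trans (add_le_add (h0 i) ?_)
  rw [norm_smul]
  exact mul_le_mul_of_nonneg_right
    ((ℓ.le_opNorm _).trans (mul_le_mul_of_nonneg_left (h0 i) (norm_nonneg _))) (norm_nonneg _)

/-- The cancellation behind diffusive scaling: the `e`-component, the one that may grow faster than
the remainder, contributes nothing to the leading increment because the jumps are centred. -/
lemma moment_increment {ℓ : E →L[ℂ] ℂ} {e : E} {A M : E →L[ℂ] E} (hMe : M e = e)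
    (hℓA : ℓ (A e) = 0) (x : E) : ℓ (A (M x)) = ℓ (A (M (x - ℓ x • e))) := by
  simp [hMe, hℓA]

/-- The second moments grow at most linearly, the fourth ones at most quadratically, and the
remainders of order `0` and `1` are bounded. -/
lemma IsMomentSeq.growth {ℓ : E →L[ℂ] ℂ} {e : E} {A : E →L[ℂ] E} {M : ι → E →L[ℂ] E}
    (hℓe : ℓ e = 1) (hMe : ∀ i, M i e = e) (hℓM : ∀ i x, ℓ (M i x) = ℓ x) (hℓA : ℓ (A e) = 0)
    (hM : ∀ i, ‖M i‖ ≤ 1) {N : ℕ} (hN : 1 ≤ N)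
    (hTN : ∀ i, ‖deflate ℓ e (M i) ^ N‖ ≤ 1 / 2) (hT : ∀ i, ‖deflate ℓ e (M i)‖ ≤ 1)
    {u : ι → ℕ → ℕ → E} (hu : ∀ i, IsMomentSeq A (M i) (u i)) {K : ℝ}
    (h0 : ∀ i m, ‖u i m 0‖ ≤ K) :
    Growth 0 (fun i n => u i 0 n - ℓ (u i 0 n) • e) ∧
    Growth 0 (fun i n => u i 1 n - ℓ (u i 1 n) • e) ∧
    Growth 1 (fun i n => ℓ (u i 2 n)) ∧ Growth 2 (fun i n => ℓ (u i 4 n)) := by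
  have hp0 : ∀ i m, ‖ℓ (u i m 0)‖ ≤ ‖ℓ‖ * K := fun i m =>
    (ℓ.le_opNorm _).trans (mul_le_mul_of_nonneg_left (h0 i m) (norm_nonneg _))
  have rem := fun {k : ℕ} {u f : ι → ℕ → E} => Growth.remainder (u := u) (f := f) (k := k) (K := K)
    hℓe hMe hℓM hN hTN hT
  have split : ∀ {k : ℕ} {u : ι → ℕ → E}, Growth k (fun i n => u i n - ℓ (u i n) • e) →
      Growth k (fun i n => ℓ (u i n)) → Growth k u := fun h1 h2 => by
    simpa using h1.add (h2.smul_const e)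
  have r0 : ∀ i n, u i 0 (n + 1) = M i (u i 0 n) := fun i n => by simp [hu i 0 n]
  have r1 : ∀ i n, u i 1 (n + 1) = M i (u i 1 n) + A (M i (u i 0 n)) := fun i n => by
    simp [hu i 1 n, Finset.sum_range_succ]
  have r2 : ∀ i n, u i 2 (n + 1) = M i (u i 2 n) +
      ((2 : ℂ) • A (M i (u i 1 n)) + (A ^ 2) (M i (u i 0 n))) := fun i n => by
    simp [hu i 2 n, Finset.sum_range_succ, add_assoc]
  have r3 : ∀ i n, u i 3 (n + 1) = M i (u i 3 n) +
      ((3 : ℂ) • A (M i (u i 2 n)) + ((3 : ℂ) • (A ^ 2) (M i (u i 1 n))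
        + (A ^ 3) (M i (u i 0 n)))) := fun i n => by
    simp [hu i 3 n, Finset.sum_range_succ, add_assoc, Nat.choose]
  have r4 : ∀ i n, u i 4 (n + 1) = M i (u i 4 n) +
      ((4 : ℂ) • A (M i (u i 3 n)) + ((6 : ℂ) • (A ^ 2) (M i (u i 2 n))
        + ((4 : ℂ) • (A ^ 3) (M i (u i 1 n)) + (A ^ 4) (M i (u i 0 n))))) := fun i n => by
    simp [hu i 4 n, Finset.sum_range_succ, add_assoc, Nat.choose]
  have gw0 : Growth 0 fun i n => u i 0 n - ℓ (u i 0 n) • e :=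
    rem (f := fun _ _ => 0) (fun i => h0 i 0) (by simpa using r0) ⟨0, by simp⟩
  have gp0 : Growth 0 fun i n => ℓ (u i 0 n) := by
    refine ⟨‖ℓ‖ * K, fun i n => ?_⟩
    induction n with
    | zero => simpa using hp0 i 0
    | succ n ih => simpa [r0, hℓM] using ih
  have g0 := split gw0 gp0
  have m0 := g0.clm hM
  have gw1 : Growth 0 fun i n => u i 1 n - ℓ (u i 1 n) • e :=
    rem (fun i => h0 i 1) r1 (m0.map A)
  have gp1 : Growth 1 fun i n => ℓ (u i 1 n) := by
    refine Growth.of_increment (f := fun i n => ℓ (A (M i (u i 0 n)))) (fun i => hp0 i 1)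
      (fun i n => ?_) ((m0.map A).map ℓ)
    simp [r1, hℓM]
  have g1 := split (gw1.mono zero_le_one) gp1
  have m1 := g1.clm hM
  have gw2 : Growth 1 fun i n => u i 2 n - ℓ (u i 2 n) • e :=
    rem (fun i => h0 i 2) r2 (((m1.map A).const_smul 2).add ((m0.mono zero_le_one).map (A ^ 2)))
  -- `u 1` is only known to be `O(n)`, which alone would give `O(n²)` here. By `moment_increment` it
  -- enters through its bounded remainder, so the increments are bounded.
  have gp2 : Growth 1 fun i n => ℓ (u i 2 n) := by
    refine Growth.of_increment (f := fun i n => (2 : ℂ) • ℓ (A (M i (u i 1 n - ℓ (u i 1 n) • e)))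
      + ℓ ((A ^ 2) (M i (u i 0 n)))) (fun i => hp0 i 2) (fun i n => ?_)
      (((((gw1.clm hM).map A).map ℓ).const_smul 2).add ((m0.map (A ^ 2)).map ℓ))
    rw [← moment_increment (hMe i) hℓA]
    simp only [r2, map_add, hℓM, map_smul]
  have g2 := split gw2 gp2
  have m2 := g2.clm hM
  have gw3 : Growth 1 fun i n => u i 3 n - ℓ (u i 3 n) • e :=
    rem (fun i => h0 i 3) r3 (((m2.map A).const_smul 3).add
      (((m1.map (A ^ 2)).const_smul 3).add ((m0.mono zero_le_one).map (A ^ 3))))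
  -- Same gain at order four: `u 3` enters only through its remainder, which is `O(n)`, so no bound
  -- on `ℓ (u 3 n)` is needed.
  have gp4 : Growth 2 fun i n => ℓ (u i 4 n) := by
    refine Growth.of_increment (f := fun i n => (4 : ℂ) • ℓ (A (M i (u i 3 n - ℓ (u i 3 n) • e)))
      + ((6 : ℂ) • ℓ ((A ^ 2) (M i (u i 2 n))) + ((4 : ℂ) • ℓ ((A ^ 3) (M i (u i 1 n)))
        + ℓ ((A ^ 4) (M i (u i 0 n)))))) (fun i => hp0 i 4) (fun i n => ?_)
      (((((gw3.clm hM).map A).map ℓ).const_smul 4).add ((((m2.map (A ^ 2)).map ℓ).const_smul 6).add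
        ((((m1.map (A ^ 3)).map ℓ).const_smul 4).add
          (((m0.mono zero_le_one).map (A ^ 4)).map ℓ))))
    rw [← moment_increment (hMe i) hℓA]
    simp only [r4, map_add, hℓM, map_smul]
  exact ⟨gw0, gw1, gp2, gp4⟩

/-- The rescaled second moment converges. -/
lemma IsMomentSeq.tendsto_second {ℓ : E →L[ℂ] ℂ} {e : E} {A M R : E →L[ℂ] E}
    (hℓe : ℓ e = 1) (hMe : M e = e) (hℓM : ∀ x, ℓ (M x) = ℓ x) (hℓA : ℓ (A e) = 0)
    (hR : ∀ x, R (x - deflate ℓ e M x) = x) {u : ℕ → ℕ → E} (hu : IsMomentSeq A M u)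
    (h0 : ℓ (u 0 0) = 1) (h2 : ℓ (u 2 0) = 0) {c : ℝ} (hc0 : ∀ n, ‖u 0 n - ℓ (u 0 n) • e‖ ≤ c)
    (hc1 : ∀ n, ‖u 1 n - ℓ (u 1 n) • e‖ ≤ c) :
    Tendsto (fun n : ℕ => (n : ℂ)⁻¹ * ℓ (u 2 n)) atTop
      (𝓝 (2 * ℓ (A (M (R (A e)))) + ℓ ((A ^ 2) e))) := by
  have r0 : ∀ n, u 0 (n + 1) = M (u 0 n) := fun n => by simp [hu 0 n]
  have r1 : ∀ n, u 1 (n + 1) = M (u 1 n) + A (M (u 0 n)) := fun n => by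
    simp [hu 1 n, Finset.sum_range_succ]
  have r2 : ∀ n, u 2 (n + 1) = M (u 2 n) +
      ((2 : ℂ) • A (M (u 1 n)) + (A ^ 2) (M (u 0 n))) := fun n => by
    simp [hu 2 n, Finset.sum_range_succ, add_assoc]
  have p0 : ∀ n, ℓ (u 0 n) = 1 := fun n => by
    induction n with
    | zero => exact h0
    | succ n ih => rw [r0, hℓM, ih]
  have w0 : ∀ n, u 0 (n + 1) - ℓ (u 0 (n + 1)) • e
      = deflate ℓ e M (u 0 n - ℓ (u 0 n) • e) + (0 - ℓ 0 • e) :=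
    remainder_succ (f := fun _ => 0) hℓe hMe hℓM (by simpa using r0)
  have c0 : Tendsto (fun n : ℕ => (n : ℂ)⁻¹ • ∑ j ∈ Finset.range n, (u 0 j - ℓ (u 0 j) • e))
      atTop (𝓝 (R 0)) :=
    tendsto_cesaro_of_affine_recursion (f := fun _ => 0 - ℓ 0 • e) hR w0 hc0 (by simp)
  -- As `ℓ (u 0 n) = 1` for every `n`, the Cesàro means of `u 0` are `e` plus those of the
  -- remainder, which tend to `R 0 = 0`.
  have s0 : Tendsto (fun n : ℕ => (n : ℂ)⁻¹ • ∑ j ∈ Finset.range n, u 0 j) atTop (𝓝 e) := by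
    have h := c0.add_const e
    simp only [map_zero, zero_add] at h
    refine h.congr' ?_
    filter_upwards [eventually_gt_atTop 0] with n hn
    have hn' : (n : ℂ) ≠ 0 := by exact_mod_cast hn.ne'
    simp only [p0, Finset.sum_sub_distrib, one_smul, Finset.sum_const, Finset.card_range, smul_sub,
      ← Nat.cast_smul_eq_nsmul ℂ, smul_smul, inv_mul_cancel₀ hn', sub_add_cancel]
  have c1 : Tendsto (fun n : ℕ => (n : ℂ)⁻¹ • ∑ j ∈ Finset.range n, (u 1 j - ℓ (u 1 j) • e))
      atTop (𝓝 (R (A e))) := by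
    refine tendsto_cesaro_of_affine_recursion hR (remainder_succ hℓe hMe hℓM r1) hc1 ?_
    -- The forcing of the first-order remainder is `G (u 0 n)`; its Cesàro mean tends to `G e`,
    -- which is `A e` because `ℓ (A e) = 0`.
    set G : E →L[ℂ] E := (ContinuousLinearMap.id ℂ E - ℓ.smulRight e).comp (A.comp M) with hG
    have hGe : G e = A e := by simp [hG, hMe, hℓA]
    rw [← hGe]
    refine ((G.continuous.tendsto _).comp s0).congr fun n => ?_
    simp [hG, smul_sub]
  have hp : ∀ n, ℓ (u 2 n) = 2 * ℓ (A (M (∑ j ∈ Finset.range n, (u 1 j - ℓ (u 1 j) • e))))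
      + ℓ ((A ^ 2) (M (∑ j ∈ Finset.range n, u 0 j))) := fun n => by
    induction n with
    | zero => simp [h2]
    | succ n ih =>
      rw [Finset.sum_range_succ, Finset.sum_range_succ]
      simp only [map_add]
      rw [← moment_increment hMe hℓA, r2]
      simp only [map_add, hℓM, ih, map_smul, smul_eq_mul]
      ring
  have t1 := (((ℓ.comp (A.comp M)).continuous.tendsto _).comp c1).const_mul 2
  have t2 := (((ℓ.comp ((A ^ 2).comp M)).continuous.tendsto _).comp s0)
  have t := t1.add t2
  simp only [ContinuousLinearMap.comp_apply, hMe] at t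
  refine t.congr fun n => ?_
  simp only [Function.comp_apply, ContinuousLinearMap.comp_apply, map_smul, smul_eq_mul, hp]
  ring

/-- The limit of the rescaled second moment, in terms of the inverse `X` of `M - (1 - e ⊗ ℓ)`. -/
lemma exists_inverse_one_sub_deflate {ℓ : E →L[ℂ] ℂ} {e : E} {A M X : E →L[ℂ] E}
    (hℓe : ℓ e = 1) (hMe : M e = e) (hℓM : ∀ x, ℓ (M x) = ℓ x) (hℓA : ℓ (A e) = 0)
    (hX : ∀ x, X (M x - x + ℓ x • e) = x) (hX' : ∀ x, M (X x) - X x + ℓ (X x) • e = x) :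
    ∃ R : E →L[ℂ] E, (∀ x, R (x - deflate ℓ e M x) = x) ∧
      2 * ℓ (A (M (R (A e)))) + ℓ ((A ^ 2) e) = -ℓ ((A ^ 2) e) - 2 * ℓ (A (X (A e))) := by
  have hXe : X e = e := by simpa [hMe, hℓe] using hX e
  have hℓX : ∀ x, ℓ (X x) = ℓ x := fun x => by
    simpa [hℓM, hℓe] using congrArg ℓ (hX' x)
  -- `1 - deflate ℓ e M` is `-(M - 1)` on `ker ℓ` and the identity on `e`, whereas `X` inverts `M -
  -- 1` on `ker ℓ` and fixes `e`. Thus the inverse is `-X` on `ker ℓ` and needs the correction `2 e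
  -- ⊗ ℓ` to be `+1` on `e`.
  refine ⟨(2 : ℂ) • ℓ.smulRight e - X, fun x => ?_, ?_⟩
  · have h := hX x
    simp only [map_add, map_sub, map_smul, hXe] at h
    have e1 : ((2 : ℂ) • ℓ.smulRight e - X) (x - deflate ℓ e M x)
        = (2 : ℂ) • ℓ (x - deflate ℓ e M x) • e - X (x - deflate ℓ e M x) := rfl
    rw [e1]
    simp only [deflate_apply, map_sub, hℓM, map_smul, hℓe, smul_eq_mul, hXe]
    rw [eq_comm, ← sub_eq_zero] at h ⊢
    rw [← h]
    module
  · have h : M (X (A e)) = A e + X (A e) := by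
      have := hX' (A e)
      rw [hℓX, hℓA, zero_smul, add_zero] at this
      rw [← sub_eq_iff_eq_add, this]
    simp [hℓA, h, pow_two]
    ring

end Moments

/-! ### From spectral radius below one to uniform power bounds. -/

section PowerBounds

variable {E : Type*} [NormedAddCommGroup E] [NormedSpace ℂ E]

/-- In finite dimension, if all eigenvalues of `T` lie in the open unit disc, then a power of `T`
has norm at most `1/2`. -/
lemma exists_norm_pow_le_half [FiniteDimensional ℂ E] [Nontrivial E] (T : E →L[ℂ] E)
    (hT : ∀ (a : ℂ) (x : E), x ≠ 0 → T x = a • x → ‖a‖ < 1) :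
    ∃ N : ℕ, 1 ≤ N ∧ ‖T ^ N‖ ≤ 1 / 2 := by
  have : CompleteSpace E := FiniteDimensional.complete ℂ E
  have hsp : ∀ a ∈ spectrum ℂ T, ‖a‖₊ < 1 := fun a ha => by
    rw [← AlgEquiv.spectrum_eq (Module.End.toContinuousLinearMap (𝕜 := ℂ) E).symm T,
      ← Module.End.hasEigenvalue_iff_mem_spectrum] at ha
    obtain ⟨x, hx⟩ := ha.exists_hasEigenvector
    exact hT a x hx.2 hx.apply_eq_smul
  have h1 := spectrum.spectralRadius_lt_of_forall_lt T hsp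
  obtain ⟨q, hq1, hq2⟩ := ENNReal.lt_iff_exists_nnreal_btwn.1 h1
  have hq2' : q < 1 := by exact_mod_cast hq2
  have h2 : ∀ᶠ n : ℕ in atTop, (q : ℝ) ^ n < 1 / 2 :=
    (tendsto_pow_atTop_nhds_zero_of_lt_one q.coe_nonneg (by exact_mod_cast hq2')).eventually
      (gt_mem_nhds (by norm_num))
  -- Gelfand's formula: `‖T^n‖^(1/n)` is eventually below any `q` above the spectral radius.
  have h3 := (spectrum.pow_nnnorm_pow_one_div_tendsto_nhds_spectralRadius T).eventually
    (gt_mem_nhds hq1)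
  obtain ⟨n, hn2, hn3, hn1⟩ := (h2.and (h3.and (eventually_ge_atTop 1))).exists
  refine ⟨n, hn1, ?_⟩
  have hn0 : (0 : ℝ) < n := by exact_mod_cast hn1
  have h4 : ((‖T ^ n‖₊ : ENNReal) ^ (1 / n : ℝ)) ^ (n : ℝ) ≤ (q : ENNReal) ^ (n : ℝ) :=
    ENNReal.rpow_le_rpow hn3.le hn0.le
  rw [← ENNReal.rpow_mul, one_div_mul_cancel hn0.ne', ENNReal.rpow_one, ENNReal.rpow_natCast] at h4
  have h5 : ‖T ^ n‖₊ ≤ q ^ n := by exact_mod_cast h4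
  have h6 : ‖T ^ n‖ ≤ (q : ℝ) ^ n := by exact_mod_cast h5
  linarith

/-- A continuous family of contractions over a compact set, each of which has a power of norm less
than `c`, has a common such power. -/
lemma exists_norm_pow_le_of_isCompact {X : Type*} [TopologicalSpace X] {s : Set X}
    (hs : IsCompact s) {T : X → E →L[ℂ] E} (hc : Continuous T) (h1 : ∀ x, ‖T x‖ ≤ 1) {b c : ℝ}
    (hbc : b < c) (h : ∀ x, ∃ N : ℕ, 1 ≤ N ∧ ‖T x ^ N‖ ≤ b) :
    ∃ N : ℕ, 1 ≤ N ∧ ∀ x ∈ s, ‖T x ^ N‖ ≤ c := by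
  -- Norms of powers of a contraction decrease, so the exponents of two sets can be merged into
  -- their maximum; this is what makes the compactness induction work.
  have mono : ∀ x (m n : ℕ), m ≤ n → ‖T x ^ n‖ ≤ ‖T x ^ m‖ := fun x m n hmn => by
    induction n, hmn using Nat.le_induction with
    | base => exact le_rfl
    | succ n _ ih =>
      rw [pow_succ]
      exact (norm_mul_le _ _).trans ((mul_le_of_le_one_right (norm_nonneg _) (h1 x)).trans ih)
  refine hs.induction_on (p := fun s => ∃ N : ℕ, 1 ≤ N ∧ ∀ x ∈ s, ‖T x ^ N‖ ≤ c) ⟨1, le_rfl, by simp⟩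
    (fun s t hst ⟨N, hN, h⟩ => ⟨N, hN, fun x hx => h x (hst hx)⟩) ?_ ?_
  · rintro s t ⟨N, hN, h⟩ ⟨N', hN', h'⟩
    refine ⟨max N N', hN.trans (le_max_left _ _), ?_⟩
    rintro x (hx | hx)
    · exact (mono x _ _ (le_max_left _ _)).trans (h x hx)
    · exact (mono x _ _ (le_max_right _ _)).trans (h' x hx)
  · intro x _
    obtain ⟨N, hN, hx⟩ := h x
    have hev : ∀ᶠ y in 𝓝 x, ‖T y ^ N‖ < c :=
      ((hc.pow N).norm.tendsto x).eventually (gt_mem_nhds (hx.trans_lt hbc))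
    exact ⟨{y | ‖T y ^ N‖ < c}, mem_nhdsWithin_of_mem_nhds hev, N, hN, fun y hy => le_of_lt hy⟩

end PowerBounds

/-! ### The operator `ℳ(-v,v)`: contraction, invariant vector and spectral gap. -/

section MeanMatrix

variable {d : ℕ} {Ω : Type*} [MeasurableSpace Ω]

/-- The space `ℂ^{2d} ⊗ ℂ^{2d}`. -/
abbrev TensorSpace (d : ℕ) : Type := EuclideanSpace ℂ (CoinIdx d × CoinIdx d)

/-- The linear form `x ↦ ⟨Ψ₁, x⟩ = ∑_τ x (τ, τ)`. -/
noncomputable def traceForm (d : ℕ) : TensorSpace d →L[ℂ] ℂ :=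
  ∑ τ : CoinIdx d, EuclideanSpace.proj (τ, τ)

lemma traceForm_apply (x : TensorSpace d) : traceForm d x = ∑ τ, x (τ, τ) := by
  simp [traceForm]

/-- The vector `Ψ₁ / 2d`. -/
noncomputable def meanVec (d : ℕ) : TensorSpace d := WithLp.toLp 2 ((2 * d : ℂ)⁻¹ • psiOne d)

lemma meanVec_apply (T : CoinIdx d × CoinIdx d) :
    meanVec d T = (2 * d : ℂ)⁻¹ * if T.1 = T.2 then 1 else 0 := by
  simp [meanVec, psiOne]

lemma card_coinIdx (d : ℕ) : Fintype.card (CoinIdx d) = 2 * d := by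
  simp [mul_comm]

lemma traceForm_meanVec [NeZero d] : traceForm d (meanVec d) = 1 := by
  have hd : (d : ℂ) ≠ 0 := by exact_mod_cast NeZero.ne d
  simp only [traceForm_apply, meanVec_apply, if_true, mul_one, Finset.sum_const, Finset.card_univ,
    card_coinIdx, nsmul_eq_mul]
  push_cast
  field_simp

/-- `ℳ(-v,v)` as an operator on the Hilbert space `ℂ^{2d} ⊗ ℂ^{2d}`. -/
noncomputable def meanOp (r : CoinIdx d → Fin d → ℤ) (μ : Measure Ω)
    (C : Ω → Matrix.unitaryGroup (CoinIdx d) ℂ) (v : Fin d → ℝ) : TensorSpace d →L[ℂ] TensorSpace d :=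
  Matrix.toEuclideanCLM (n := CoinIdx d × CoinIdx d) (𝕜 := ℂ) (meanMat r μ C (-v) v)

lemma norm_toEuclideanCLM_of_unitary {n : Type*} [Fintype n] [DecidableEq n] {U : Matrix n n ℂ}
    (hU : U ∈ unitary (Matrix n n ℂ)) (x : EuclideanSpace ℂ n) :
    ‖Matrix.toEuclideanCLM (n := n) (𝕜 := ℂ) U x‖ = ‖x‖ :=
  ContinuousLinearMap.norm_map_of_mem_unitary (Unitary.map_mem _ hU) x

lemma tensor_mem_unitary (U : Matrix.unitaryGroup (CoinIdx d) ℂ) :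
    (U : Matrix (CoinIdx d) (CoinIdx d) ℂ) ⊗ₖ (U : Matrix (CoinIdx d) (CoinIdx d) ℂ).map
      (starRingEnd ℂ) ∈ unitary (Mat2 d) :=
  Matrix.kronecker_mem_unitary U.2 (Matrix.map_star_mem_unitaryGroup_iff.2 U.2)

variable {r : CoinIdx d → Fin d → ℤ} {μ : Measure Ω} {C : Ω → Matrix.unitaryGroup (CoinIdx d) ℂ}

lemma integrable_tensor [IsFiniteMeasure μ] (hC : ∀ σ τ, Measurable fun ω =>
      (C ω : Matrix (CoinIdx d) (CoinIdx d) ℂ) σ τ) (S T : CoinIdx d × CoinIdx d) :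
    Integrable (fun ω => ((C ω : Matrix (CoinIdx d) (CoinIdx d) ℂ) ⊗ₖ
      (C ω : Matrix (CoinIdx d) (CoinIdx d) ℂ).map (starRingEnd ℂ)) S T) μ := by
  refine Integrable.of_bound (C := 1) ?_ (ae_of_all _ fun ω => ?_)
  · simp only [Matrix.kroneckerMap_apply, Matrix.map_apply]
    exact ((hC _ _).mul (Complex.continuous_conj.measurable.comp (hC _ _))).aestronglyMeasurable
  · exact entry_norm_bound_of_unitary (tensor_mem_unitary (C ω)) S T

/-- An average of unitary operators is a contraction. -/
lemma norm_meanTensor_le [IsProbabilityMeasure μ] (hC : ∀ σ τ, Measurable fun ω =>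
      (C ω : Matrix (CoinIdx d) (CoinIdx d) ℂ) σ τ) (x : TensorSpace d) :
    ‖Matrix.toEuclideanCLM (n := CoinIdx d × CoinIdx d) (𝕜 := ℂ) (meanTensor μ C) x‖ ≤ ‖x‖ := by
  have h : Matrix.toEuclideanCLM (n := CoinIdx d × CoinIdx d) (𝕜 := ℂ) (meanTensor μ C) x
      = ∫ ω, Matrix.toEuclideanCLM (n := CoinIdx d × CoinIdx d) (𝕜 := ℂ)
        ((C ω : Matrix (CoinIdx d) (CoinIdx d) ℂ) ⊗ₖ
      (C ω : Matrix (CoinIdx d) (CoinIdx d) ℂ).map (starRingEnd ℂ)) x ∂μ := by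
    ext S
    rw [eval_integral_piLp]
    · simp only [Matrix.ofLp_toEuclideanCLM, Matrix.mulVec, dotProduct]
      rw [integral_finsetSum _ fun T _ => (integrable_tensor hC S T).mul_const _]
      simp_rw [integral_mul_const]
      rfl
    · intro S
      simp only [Matrix.ofLp_toEuclideanCLM, Matrix.mulVec, dotProduct]
      exact integrable_finsetSum _ fun T _ => (integrable_tensor hC S T).mul_const _
  rw [h]
  refine (norm_integral_le_integral_norm _).trans ?_
  simp [norm_toEuclideanCLM_of_unitary (tensor_mem_unitary _)]

lemma phaseMat_mem_unitary (r : CoinIdx d → Fin d → ℤ) (y y' : Fin d → ℝ) :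
    phaseMat r y y' ∈ unitary (Mat2 d) := by
  have h : star (phaseMat r y y') * phaseMat r y y' = 1 := by
    rw [phaseMat, Matrix.star_eq_conjTranspose, Matrix.diagonal_conjTranspose,
      Matrix.diagonal_mul_diagonal, ← Matrix.diagonal_one]
    congr 1
    funext T
    rw [Pi.star_apply, RCLike.star_def, ← Complex.exp_conj, ← Complex.exp_add]
    simp [Complex.conj_ofReal]
  exact Matrix.mem_unitaryGroup_iff'.2 h

lemma norm_meanOp_le [IsProbabilityMeasure μ] (hC : ∀ σ τ, Measurable fun ω =>
      (C ω : Matrix (CoinIdx d) (CoinIdx d) ℂ) σ τ) (v : Fin d → ℝ) : ‖meanOp r μ C v‖ ≤ 1 := by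
  refine ContinuousLinearMap.opNorm_le_bound _ zero_le_one fun x => ?_
  rw [meanOp, meanMat, map_mul, mul_apply_eq_comp, one_mul,
    norm_toEuclideanCLM_of_unitary (phaseMat_mem_unitary _ _ _)]
  exact norm_meanTensor_le hC x

/-- Entrywise this is `U U* = 1`; the dual identity for rows, below, is `U* U = 1`. -/
lemma tensor_mulVec_psiOne (U : Matrix.unitaryGroup (CoinIdx d) ℂ) (S : CoinIdx d × CoinIdx d) :
    ∑ T, ((U : Matrix (CoinIdx d) (CoinIdx d) ℂ) ⊗ₖ
      (U : Matrix (CoinIdx d) (CoinIdx d) ℂ).map (starRingEnd ℂ)) S T * psiOne d T = psiOne d S := by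
  have h := congrFun (congrFun (Matrix.mem_unitaryGroup_iff.1 U.2) S.1) S.2
  rw [Fintype.sum_prod_type]
  simpa [psiOne, Matrix.mul_apply, Matrix.one_apply] using h

lemma psiOne_vecMul_tensor (U : Matrix.unitaryGroup (CoinIdx d) ℂ) (T : CoinIdx d × CoinIdx d) :
    ∑ τ, ((U : Matrix (CoinIdx d) (CoinIdx d) ℂ) ⊗ₖ
      (U : Matrix (CoinIdx d) (CoinIdx d) ℂ).map (starRingEnd ℂ)) (τ, τ) T = psiOne d T := by
  have h := congrFun (congrFun (Matrix.mem_unitaryGroup_iff'.1 U.2) T.2) T.1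
  simp only [psiOne, eq_comm (a := T.1)]
  simpa [Matrix.mul_apply, Matrix.one_apply, mul_comm] using h

/-- At `(-v,v)` the phases cancel on the diagonal, which supports `Ψ₁`; hence `e` and `ℓ` are
invariant for every `v`. -/
lemma phaseMat_diag (r : CoinIdx d → Fin d → ℤ) (v : Fin d → ℝ) (τ : CoinIdx d) :
    phaseMat r (-v) v (τ, τ) (τ, τ) = 1 := by
  simp [phaseMat]

lemma meanMat_apply (S T : CoinIdx d × CoinIdx d) (v : Fin d → ℝ) :
    meanMat r μ C (-v) v S T = phaseMat r (-v) v S S * meanTensor μ C S T := by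
  simp [meanMat, phaseMat, Matrix.diagonal_mul]

lemma meanTensor_mulVec_psiOne [IsProbabilityMeasure μ] (hC : ∀ σ τ, Measurable fun ω =>
      (C ω : Matrix (CoinIdx d) (CoinIdx d) ℂ) σ τ) (S : CoinIdx d × CoinIdx d) :
    ∑ T, meanTensor μ C S T * psiOne d T = psiOne d S := by
  simp_rw [meanTensor, ← integral_mul_const]
  rw [← integral_finsetSum _ fun T _ => (integrable_tensor hC S T).mul_const _]
  simp_rw [tensor_mulVec_psiOne]
  simp

lemma psiOne_vecMul_meanTensor [IsProbabilityMeasure μ] (hC : ∀ σ τ, Measurable fun ω =>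
      (C ω : Matrix (CoinIdx d) (CoinIdx d) ℂ) σ τ) (T : CoinIdx d × CoinIdx d) :
    ∑ τ, meanTensor μ C (τ, τ) T = psiOne d T := by
  simp_rw [meanTensor]
  rw [← integral_finsetSum _ fun τ _ => integrable_tensor hC (τ, τ) T]
  simp_rw [psiOne_vecMul_tensor]
  simp

lemma meanMat_mulVec_psiOne [IsProbabilityMeasure μ] (hC : ∀ σ τ, Measurable fun ω =>
      (C ω : Matrix (CoinIdx d) (CoinIdx d) ℂ) σ τ) (v : Fin d → ℝ) :
    (meanMat r μ C (-v) v).mulVec (psiOne d) = psiOne d := by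
  funext S
  simp only [Matrix.mulVec, dotProduct, meanMat_apply, mul_assoc, ← Finset.mul_sum,
    meanTensor_mulVec_psiOne hC]
  by_cases h : S.1 = S.2
  · obtain ⟨σ, τ⟩ := S
    obtain rfl : σ = τ := h
    rw [phaseMat_diag, one_mul]
  · simp [psiOne, h]

lemma meanOp_meanVec [IsProbabilityMeasure μ] (hC : ∀ σ τ, Measurable fun ω =>
      (C ω : Matrix (CoinIdx d) (CoinIdx d) ℂ) σ τ) (v : Fin d → ℝ) :
    meanOp r μ C v (meanVec d) = meanVec d := by
  rw [meanOp, meanVec, Matrix.toEuclideanCLM_toLp, Matrix.mulVec_smul, meanMat_mulVec_psiOne hC]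

lemma traceForm_meanOp [IsProbabilityMeasure μ] (hC : ∀ σ τ, Measurable fun ω =>
      (C ω : Matrix (CoinIdx d) (CoinIdx d) ℂ) σ τ) (v : Fin d → ℝ) (x : TensorSpace d) :
    traceForm d (meanOp r μ C v x) = traceForm d x := by
  simp only [traceForm_apply, meanOp, Matrix.ofLp_toEuclideanCLM, Matrix.mulVec, dotProduct,
    meanMat_apply, phaseMat_diag, one_mul]
  rw [Finset.sum_comm]
  simp_rw [← Finset.sum_mul, psiOne_vecMul_meanTensor hC]
  rw [Fintype.sum_prod_type]
  simp [psiOne]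

/-- Since `⟨e, ·⟩ = ℓ/2d`, the map `x ↦ x - ℓ(x) e` is the orthogonal projection `Q`. -/
lemma norm_sub_traceForm_smul_le [NeZero d] (x : TensorSpace d) :
    ‖x - traceForm d x • meanVec d‖ ≤ ‖x‖ := by
  have hd : (d : ℂ) ≠ 0 := by exact_mod_cast NeZero.ne d
  have hin : ∀ y : TensorSpace d, inner ℂ (meanVec d) y = (2 * d : ℂ)⁻¹ * traceForm d y := fun y => by
    rw [PiLp.inner_apply, Fintype.sum_prod_type, traceForm_apply, Finset.mul_sum]
    simp [meanVec_apply, apply_ite, mul_comm, Complex.conj_ofNat]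
  have h0 : inner ℂ (traceForm d x • meanVec d) (x - traceForm d x • meanVec d) = 0 := by
    rw [inner_smul_left, hin, map_sub, map_smul, traceForm_meanVec]
    simp
  have h := norm_add_sq_eq_norm_sq_add_norm_sq_of_inner_eq_zero _ _ h0
  rw [add_sub_cancel] at h
  nlinarith [norm_nonneg x, norm_nonneg (x - traceForm d x • meanVec d),
    mul_self_nonneg ‖traceForm d x • meanVec d‖]

lemma norm_deflate_meanOp_le [NeZero d] [IsProbabilityMeasure μ] (hC : ∀ σ τ, Measurable fun ω =>
      (C ω : Matrix (CoinIdx d) (CoinIdx d) ℂ) σ τ) (v : Fin d → ℝ) :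
    ‖deflate (traceForm d) (meanVec d) (meanOp r μ C v)‖ ≤ 1 := by
  refine ContinuousLinearMap.opNorm_le_bound _ zero_le_one fun x => ?_
  have : deflate (traceForm d) (meanVec d) (meanOp r μ C v) x
      = meanOp r μ C v (x - traceForm d x • meanVec d) := by
    rw [deflate_apply, map_sub, map_smul, meanOp_meanVec hC]
  rw [this, one_mul]
  exact ((meanOp r μ C v).le_of_opNorm_le (norm_meanOp_le hC v) _).trans
    (by simpa using norm_sub_traceForm_smul_le x)

/-- Under Assumption S, all eigenvalues of the deflated operator lie in the open unit disc. -/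
lemma AssumptionS.norm_eigenvalue_lt [NeZero d] [IsProbabilityMeasure μ]
    (hS : AssumptionS r μ C) (hC : ∀ σ τ, Measurable fun ω =>
      (C ω : Matrix (CoinIdx d) (CoinIdx d) ℂ) σ τ) (v : Fin d → ℝ) (a : ℂ) (x : TensorSpace d)
    (hx : x ≠ 0) (h : deflate (traceForm d) (meanVec d) (meanOp r μ C v) x = a • x) : ‖a‖ < 1 := by
  have hle : ‖a‖ ≤ 1 := by
    have h1 := (deflate (traceForm d) (meanVec d) (meanOp r μ C v)).le_of_opNorm_le
      (norm_deflate_meanOp_le hC v) x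
    rw [h, norm_smul] at h1
    exact le_of_mul_le_mul_right h1 (norm_pos_iff.2 hx)
  refine lt_of_le_of_ne hle fun ha => ?_
  have ha0 : a ≠ 0 := by rintro rfl; simp at ha
  -- `ℓ` vanishes on the range of the deflated operator, so an eigenvector with `a ≠ 0` has trace
  -- zero and is an eigenvector of `ℳ(-v,v)` itself.
  have hℓ : traceForm d x = 0 := by
    have := congrArg (traceForm d) h
    rw [deflate_apply, map_sub, map_smul, traceForm_meanOp hC, traceForm_meanVec, smul_eq_mul,
      mul_one, sub_self, map_smul, smul_eq_mul] at this
    exact (mul_eq_zero.1 this.symm).resolve_left ha0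
  rw [deflate_apply, hℓ, zero_smul, sub_zero, meanOp] at h
  have hx' : (meanMat r μ C (-v) v).mulVec x.ofLp = a • x.ofLp := by
    rw [← Matrix.ofLp_toEuclideanCLM, h]; rfl
  have hxo : x.ofLp ≠ 0 := fun h0 => hx (by ext i; simp [h0])
  have hmem : a ∈ spectrum ℂ (meanMat r μ C (-v) v) := by
    rw [← Matrix.spectrum_toLin', ← Module.End.hasEigenvalue_iff_mem_spectrum]
    exact Module.End.hasEigenvalue_of_hasEigenvector
      ⟨Module.End.mem_eigenspace_iff.2 (by simpa using hx'), hxo⟩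
  obtain rfl : a = 1 := by
    have : a ∈ spectrum ℂ (meanMat r μ C (-v) v) ∩ Metric.sphere (0 : ℂ) 1 := ⟨hmem, by simpa using ha⟩
    rw [(hS v).1] at this
    exact this
  -- Algebraic simplicity makes the eigenspace at `1` a line. It contains `Ψ₁`, of trace `2d ≠ 0`,
  -- so a vector of trace zero in it must vanish.
  have hfin := LinearMap.finrank_eigenspace_le (Matrix.toLin' (meanMat r μ C (-v) v)) 1
  rw [Matrix.charpoly_toLin', (hS v).2, finrank_le_one_iff] at hfin
  obtain ⟨⟨w, hw⟩, hw'⟩ := hfin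
  obtain ⟨c, hc⟩ := hw' ⟨x.ofLp, Module.End.mem_eigenspace_iff.2 (by simpa using hx')⟩
  obtain ⟨c', hc'⟩ := hw' ⟨psiOne d, Module.End.mem_eigenspace_iff.2
    (by simpa using meanMat_mulVec_psiOne hC v)⟩
  have hc := congrArg Subtype.val hc
  have hc' := congrArg Subtype.val hc'
  simp only [SetLike.mk_smul_mk] at hc hc'
  have e1 : c * ∑ τ, w (τ, τ) = 0 := by
    rw [Finset.mul_sum, ← hℓ, traceForm_apply, ← hc]; simp
  have e2 : c' * ∑ τ, w (τ, τ) = 2 * d := by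
    rw [Finset.mul_sum]
    have : ∀ τ : CoinIdx d, c' * w (τ, τ) = 1 := fun τ => by
      have := congrFun hc' (τ, τ)
      simpa [psiOne] using this
    simp only [this, Finset.sum_const, Finset.card_univ, card_coinIdx]
    simp
  have hd : (d : ℂ) ≠ 0 := by exact_mod_cast NeZero.ne d
  have h3 : ∑ τ, w (τ, τ) ≠ 0 := by
    intro h0
    rw [h0, mul_zero] at e2
    exact mul_ne_zero two_ne_zero hd e2.symm
  have h4 : c = 0 := (mul_eq_zero.1 e1).resolve_right h3
  exact hxo (by rw [← hc, h4, zero_smul])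

lemma continuous_phaseMat (r : CoinIdx d → Fin d → ℤ) :
    Continuous fun v : Fin d → ℝ => phaseMat r (-v) v := by
  unfold phaseMat
  refine Continuous.matrix_diagonal (continuous_pi fun T => ?_)
  simp only [Pi.neg_apply]
  fun_prop

lemma continuous_meanMat : Continuous fun v : Fin d → ℝ => meanMat r μ C (-v) v :=
  (continuous_phaseMat r).matrix_mul continuous_const

lemma continuous_meanOp : Continuous (meanOp r μ C) :=
  (LinearMap.continuous_of_finiteDimensional
    (Matrix.toEuclideanCLM (n := CoinIdx d × CoinIdx d) (𝕜 := ℂ)).toAlgEquiv.toLinearMap).comp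
    continuous_meanMat

/-- Under Assumption S, the deflated transfer operators contract uniformly over a period. -/
lemma AssumptionS.exists_uniform_contraction [NeZero d] [IsProbabilityMeasure μ]
    (hS : AssumptionS r μ C) (hC : ∀ σ τ, Measurable fun ω =>
      (C ω : Matrix (CoinIdx d) (CoinIdx d) ℂ) σ τ) {K : Set (Fin d → ℝ)} (hK : IsCompact K) :
    ∃ N : ℕ, 1 ≤ N ∧
      ∀ v ∈ K, ‖deflate (traceForm d) (meanVec d) (meanOp r μ C v) ^ N‖ ≤ 1 / 2 := by
  have : Nonempty (Fin d) := ⟨⟨0, Nat.pos_of_ne_zero (NeZero.ne d)⟩⟩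
  have hhalf : ∀ v, ∃ N : ℕ, 1 ≤ N ∧
      ‖deflate (traceForm d) (meanVec d) (meanOp r μ C v) ^ N‖ ≤ 1 / 4 := fun v => by
    obtain ⟨N, hN, h⟩ := exists_norm_pow_le_half _ (hS.norm_eigenvalue_lt hC v)
    -- Squaring improves `1/2` to `1/4`, leaving the strict gap that the compactness argument
    -- consumes.
    refine ⟨N * 2, by omega, ?_⟩
    rw [pow_mul]
    refine (norm_pow_le' _ two_pos).trans ?_
    nlinarith [norm_nonneg (deflate (traceForm d) (meanVec d) (meanOp r μ C v) ^ N)]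
  exact exists_norm_pow_le_of_isCompact hK (continuous_meanOp.sub continuous_const)
    (norm_deflate_meanOp_le hC) (by norm_num) hhalf

end MeanMatrix

/-! ### The reduced resolvent and the identification of the limit with `𝔻(v)`. -/

section Resolvent

variable {d : ℕ} {Ω : Type*} [MeasurableSpace Ω]
variable {r : CoinIdx d → Fin d → ℤ} {μ : Measure Ω} {C : Ω → Matrix.unitaryGroup (CoinIdx d) ℂ}

lemma sum_mul_psiOne (f : CoinIdx d × CoinIdx d → ℂ) :
    ∑ T, f T * psiOne d T = ∑ τ, f (τ, τ) := by
  rw [Fintype.sum_prod_type]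
  refine Finset.sum_congr rfl fun τ _ => ?_
  simp only [psiOne, mul_ite, mul_one, mul_zero, Finset.sum_ite_eq, Finset.mem_univ, if_true]

lemma projP_apply (S T : CoinIdx d × CoinIdx d) :
    projP d S T = (2 * d : ℂ)⁻¹ * (psiOne d S * psiOne d T) := by
  have h : star (psiOne d) = psiOne d := by
    funext T
    simp [psiOne, apply_ite]
  rw [projP, h]
  rfl

lemma sum_mul_meanVec (f : CoinIdx d × CoinIdx d → ℂ) :
    ∑ T, f T * meanVec d T = (2 * d : ℂ)⁻¹ * ∑ τ, f (τ, τ) := by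
  rw [← sum_mul_psiOne, Finset.mul_sum]
  exact Finset.sum_congr rfl fun T _ => mul_left_comm _ _ _

lemma toEuclideanCLM_apply_apply (B : Mat2 d) (x : TensorSpace d) (S : CoinIdx d × CoinIdx d) :
    Matrix.toEuclideanCLM (n := CoinIdx d × CoinIdx d) (𝕜 := ℂ) B x S = ∑ T, B S T * x T := rfl

lemma toEuclideanCLM_projP (x : TensorSpace d) :
    Matrix.toEuclideanCLM (n := CoinIdx d × CoinIdx d) (𝕜 := ℂ) (projP d) x
      = traceForm d x • meanVec d := by
  ext S
  have h : ∀ T, projP d S T * x T = (2 * d : ℂ)⁻¹ * psiOne d S * (x T * psiOne d T) := fun T => by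
    rw [projP_apply]; ring
  simp only [Matrix.ofLp_toEuclideanCLM, Matrix.mulVec, dotProduct, h, ← Finset.mul_sum,
    sum_mul_psiOne, PiLp.smul_apply, smul_eq_mul, traceForm_apply, meanVec, Pi.smul_apply]
  ring

/-- The matrix `ℳ(-v,v) - Q`, whose inverse is `P + S_v(1)`. -/
noncomputable def shiftedMat (r : CoinIdx d → Fin d → ℤ) (μ : Measure Ω)
    (C : Ω → Matrix.unitaryGroup (CoinIdx d) ℂ) (v : Fin d → ℝ) : Mat2 d :=
  meanMat r μ C (-v) v - (1 - projP d)

lemma toEuclideanCLM_shiftedMat (v : Fin d → ℝ) (x : TensorSpace d) :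
    Matrix.toEuclideanCLM (n := CoinIdx d × CoinIdx d) (𝕜 := ℂ) (shiftedMat r μ C v) x
      = meanOp r μ C v x - x + traceForm d x • meanVec d := by
  rw [shiftedMat, map_sub, map_sub, map_one, ← toEuclideanCLM_projP]
  change meanOp r μ C v x - (x - _) = _
  abel

/-- Taking the trace of a kernel equation forces `ℓ(x) = 0`, hence `M x = x`, and `1` would be an
eigenvalue of the deflated operator. -/
lemma AssumptionS.det_shiftedMat_ne_zero [NeZero d] [IsProbabilityMeasure μ]
    (hS : AssumptionS r μ C) (hC : ∀ σ τ, Measurable fun ω =>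
      (C ω : Matrix (CoinIdx d) (CoinIdx d) ℂ) σ τ) (v : Fin d → ℝ) :
    (shiftedMat r μ C v).det ≠ 0 := by
  intro h
  obtain ⟨y, hy, h⟩ := Matrix.exists_mulVec_eq_zero_iff.2 h
  set x : TensorSpace d := WithLp.toLp 2 y
  have h1 : meanOp r μ C v x - x + traceForm d x • meanVec d = 0 := by
    rw [← toEuclideanCLM_shiftedMat, Matrix.toEuclideanCLM_toLp, h]; rfl
  have h2 : traceForm d x = 0 := by
    simpa [traceForm_meanOp hC, traceForm_meanVec] using congrArg (traceForm d) h1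
  rw [h2, zero_smul, add_zero, sub_eq_zero] at h1
  have h3 := hS.norm_eigenvalue_lt hC v 1 x (fun h0 => hy (congrArg WithLp.ofLp h0))
    (by rw [deflate_apply, h1, h2]; simp)
  simp at h3

/-- `(ℳ(-v,v) - Q)⁻¹` as an operator. -/
noncomputable def shiftedInv (r : CoinIdx d → Fin d → ℤ) (μ : Measure Ω)
    (C : Ω → Matrix.unitaryGroup (CoinIdx d) ℂ) (v : Fin d → ℝ) : TensorSpace d →L[ℂ] TensorSpace d :=
  Matrix.toEuclideanCLM (n := CoinIdx d × CoinIdx d) (𝕜 := ℂ) (shiftedMat r μ C v)⁻¹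

lemma AssumptionS.shiftedInv_apply [NeZero d] [IsProbabilityMeasure μ]
    (hS : AssumptionS r μ C) (hC : ∀ σ τ, Measurable fun ω =>
      (C ω : Matrix (CoinIdx d) (CoinIdx d) ℂ) σ τ) (v : Fin d → ℝ) (x : TensorSpace d) :
    shiftedInv r μ C v (meanOp r μ C v x - x + traceForm d x • meanVec d) = x := by
  rw [← toEuclideanCLM_shiftedMat, shiftedInv, ← mul_apply_eq_comp, ← map_mul,
    Matrix.nonsing_inv_mul _ (hS.det_shiftedMat_ne_zero hC v).isUnit, map_one, one_apply_eq_self]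

lemma AssumptionS.apply_shiftedInv [NeZero d] [IsProbabilityMeasure μ]
    (hS : AssumptionS r μ C) (hC : ∀ σ τ, Measurable fun ω =>
      (C ω : Matrix (CoinIdx d) (CoinIdx d) ℂ) σ τ) (v : Fin d → ℝ) (x : TensorSpace d) :
    meanOp r μ C v (shiftedInv r μ C v x) - shiftedInv r μ C v x
      + traceForm d (shiftedInv r μ C v x) • meanVec d = x := by
  rw [← toEuclideanCLM_shiftedMat, shiftedInv, ← mul_apply_eq_comp, ← map_mul,
    Matrix.mul_nonsing_inv _ (hS.det_shiftedMat_ne_zero hC v).isUnit, map_one, one_apply_eq_self]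

/-- `ℳ(-v,v) - Q` fixes `e`, so its inverse does too. The column version below comes from the
invariance of `ℓ`. -/
lemma AssumptionS.sum_row_shiftedMat_inv [NeZero d] [IsProbabilityMeasure μ]
    (hS : AssumptionS r μ C) (hC : ∀ σ τ, Measurable fun ω =>
      (C ω : Matrix (CoinIdx d) (CoinIdx d) ℂ) σ τ) (v : Fin d → ℝ) (τ : CoinIdx d) :
    ∑ τ', (shiftedMat r μ C v)⁻¹ (τ, τ) (τ', τ') = 1 := by
  have hd : (d : ℂ) ≠ 0 := by exact_mod_cast NeZero.ne d
  have h := hS.shiftedInv_apply hC v (meanVec d)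
  rw [meanOp_meanVec hC, traceForm_meanVec, sub_self, zero_add, one_smul, shiftedInv] at h
  have h' := congrArg (fun x : TensorSpace d => x (τ, τ)) h
  simp only [toEuclideanCLM_apply_apply, sum_mul_meanVec] at h'
  rw [meanVec_apply, if_pos rfl] at h'
  exact mul_left_cancel₀ (inv_ne_zero (mul_ne_zero two_ne_zero hd)) h'

lemma AssumptionS.sum_col_shiftedMat_inv [NeZero d] [IsProbabilityMeasure μ]
    (hS : AssumptionS r μ C) (hC : ∀ σ τ, Measurable fun ω =>
      (C ω : Matrix (CoinIdx d) (CoinIdx d) ℂ) σ τ) (v : Fin d → ℝ) (τ : CoinIdx d) :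
    ∑ τ', (shiftedMat r μ C v)⁻¹ (τ', τ') (τ, τ) = 1 := by
  have h := congrArg (traceForm d) (hS.apply_shiftedInv hC v (EuclideanSpace.single (τ, τ) 1))
  simp only [map_add, map_sub, traceForm_meanOp hC, sub_self, zero_add, map_smul,
    traceForm_meanVec, smul_eq_mul, mul_one] at h
  have h1 : traceForm d (EuclideanSpace.single (τ, τ) 1) = 1 := by
    rw [traceForm_apply, Finset.sum_eq_single τ (fun σ _ hσ => by simp [hσ]) (by simp)]
    simp
  rw [h1, traceForm_apply] at h
  simpa [shiftedInv] using h

/-- The multiplication operator by the centred jump of the first factor, in the direction `z`. -/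
noncomputable def jumpOp (r : CoinIdx d → Fin d → ℤ) (z : Fin d → ℝ) :
    TensorSpace d →L[ℂ] TensorSpace d :=
  Matrix.toEuclideanCLM (n := CoinIdx d × CoinIdx d) (𝕜 := ℂ)
    (Matrix.diagonal fun T => (((z ⬝ᵥ fun i => (r T.1 i - meanJump r i : ℝ)) : ℝ) : ℂ))

lemma jumpOp_apply (z : Fin d → ℝ) (x : TensorSpace d) (T : CoinIdx d × CoinIdx d) :
    jumpOp r z x T = (((z ⬝ᵥ fun i => (r T.1 i - meanJump r i : ℝ)) : ℝ) : ℂ) * x T := by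
  simp [jumpOp, Matrix.mulVec_diagonal]

lemma jumpOp_pow_apply (z : Fin d → ℝ) (x : TensorSpace d) (T : CoinIdx d × CoinIdx d) (j : ℕ) :
    (jumpOp r z ^ j) x T = (((z ⬝ᵥ fun i => (r T.1 i - meanJump r i : ℝ)) : ℝ) : ℂ) ^ j * x T := by
  induction j with
  | zero => simp
  | succ j ih => rw [pow_succ', mul_apply_eq_comp, jumpOp_apply, ih, pow_succ']; ring

lemma dotProduct_centred (z : Fin d → ℝ) (τ : CoinIdx d) :
    (((z ⬝ᵥ fun i => (r τ i - meanJump r i : ℝ)) : ℝ) : ℂ)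
      = ∑ i, (z i : ℂ) * r τ i - ∑ i, (z i : ℂ) * meanJump r i := by
  simp [dotProduct, mul_sub, Finset.sum_sub_distrib]

lemma sum_jump [NeZero d] (z : Fin d → ℝ) :
    ∑ τ, ∑ i, (z i : ℂ) * r τ i = (2 * d : ℂ) * ∑ i, (z i : ℂ) * meanJump r i := by
  have hd : (d : ℂ) ≠ 0 := by exact_mod_cast NeZero.ne d
  rw [Finset.sum_comm, Finset.mul_sum]
  refine Finset.sum_congr rfl fun i _ => ?_
  rw [← Finset.mul_sum, meanJump]
  push_cast
  field_simp

lemma traceForm_jumpOp_meanVec [NeZero d] (z : Fin d → ℝ) :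
    traceForm d (jumpOp r z (meanVec d)) = 0 := by
  simp only [traceForm_apply, jumpOp_apply, meanVec_apply, if_true, ← Finset.sum_mul,
    dotProduct_centred, Finset.sum_sub_distrib, sum_jump, Finset.sum_const, Finset.card_univ,
    card_coinIdx, nsmul_eq_mul]
  push_cast
  ring

/-- Passes from centred jumps `b - β` and `X = P + S_v(1)` to raw jumps and `S_v(1)`. Unit row and
column sums turn every cross term into a multiple of `s β²`, and `s⁻¹` is the entry of `P` between
diagonal indices. -/
lemma centred_quadratic_identity {κ : Type*} [Fintype κ] {s β : ℂ} (hs : s ≠ 0)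
    (hcard : (Fintype.card κ : ℂ) = s) {b : κ → ℂ} (hb : ∑ τ, b τ = s * β) {X : κ → κ → ℂ}
    (hrow : ∀ τ, ∑ τ', X τ τ' = 1) (hcol : ∀ τ', ∑ τ, X τ τ' = 1) :
    -(s⁻¹ * ∑ τ, (b τ - β) ^ 2) - 2 * (s⁻¹ * ∑ τ, ∑ τ', (b τ - β) * X τ τ' * (b τ' - β))
      = β ^ 2 - s⁻¹ * ∑ τ, b τ ^ 2
        - 2 * (s⁻¹ * ∑ τ, ∑ τ', b τ * b τ' * (X τ τ' - s⁻¹)) := by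
  have h1 : ∑ τ, (b τ - β) ^ 2 = ∑ τ, b τ ^ 2 - s * β ^ 2 := by
    simp only [sub_sq, Finset.sum_add_distrib, Finset.sum_sub_distrib, ← Finset.sum_mul,
      ← Finset.mul_sum, hb, Finset.sum_const, Finset.card_univ, nsmul_eq_mul, hcard]
    ring
  have h2 : ∑ τ, ∑ τ', (b τ - β) * X τ τ' * (b τ' - β)
      = ∑ τ, ∑ τ', b τ * b τ' * X τ τ' - s * β ^ 2 := by
    have e : ∀ τ τ', (b τ - β) * X τ τ' * (b τ' - β)
        = b τ * b τ' * X τ τ' - b τ * β * X τ τ' - X τ τ' * (β * b τ') + β ^ 2 * X τ τ' :=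
      fun _ _ => by ring
    simp only [e, Finset.sum_add_distrib, Finset.sum_sub_distrib]
    rw [Finset.sum_comm (f := fun τ τ' => X τ τ' * (β * b τ'))]
    simp only [← Finset.sum_mul, ← Finset.mul_sum, hrow, hcol, hb, one_mul, mul_one,
      Finset.sum_const, Finset.card_univ, nsmul_eq_mul, hcard]
    ring
  have h3 : ∑ τ, ∑ τ', b τ * b τ' * (X τ τ' - s⁻¹)
      = ∑ τ, ∑ τ', b τ * b τ' * X τ τ' - s * β ^ 2 := by
    simp only [mul_sub, Finset.sum_sub_distrib, ← Finset.sum_mul, ← Finset.mul_sum, hb]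
    field_simp
  rw [h1, h2, h3]
  field_simp
  ring

lemma sum_sum_diffusionAt (v : Fin d → ℝ) (z : Fin d → ℝ) :
    ∑ i, ∑ j, (z i : ℂ) * diffusionAt r μ C v i j * (z j : ℂ)
      = (∑ i, (z i : ℂ) * meanJump r i) ^ 2
        - (2 * d : ℂ)⁻¹ * ∑ τ, (∑ i, (z i : ℂ) * r τ i) ^ 2
        - 2 * ((2 * d : ℂ)⁻¹ * ∑ τ, ∑ τ', (∑ i, (z i : ℂ) * r τ i) * (∑ i, (z i : ℂ) * r τ' i)
          * reducedResolvent r μ C v (τ, τ) (τ', τ')) := by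
  have hq : ∀ a b : Fin d → ℂ, ∑ i, ∑ j, (z i : ℂ) * (a i * b j) * (z j : ℂ)
      = (∑ i, (z i : ℂ) * a i) * ∑ i, (z i : ℂ) * b i := fun a b => by
    rw [Finset.sum_mul_sum]
    exact Finset.sum_congr rfl fun i _ => Finset.sum_congr rfl fun j _ => by ring
  have hlin : ∀ {κ : Type} [Fintype κ] (G : κ → Fin d → Fin d → ℂ),
      ∑ i, ∑ j, (z i : ℂ) * (∑ τ, G τ i j) * (z j : ℂ)
        = ∑ τ, ∑ i, ∑ j, (z i : ℂ) * G τ i j * (z j : ℂ) := fun G => by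
    simp only [Finset.mul_sum, Finset.sum_mul]
    exact (Finset.sum_comm.trans (Finset.sum_congr rfl fun i _ => Finset.sum_comm)).symm
  have hc : ∀ (c : ℂ) (G : Fin d → Fin d → ℂ), ∑ i, ∑ j, (z i : ℂ) * (c * G i j) * (z j : ℂ)
      = c * ∑ i, ∑ j, (z i : ℂ) * G i j * (z j : ℂ) := fun c G => by
    simp only [Finset.mul_sum]
    exact Finset.sum_congr rfl fun i _ => Finset.sum_congr rfl fun j _ => by ring
  have hs : ∀ (c : ℂ) (G : Fin d → Fin d → ℂ), ∑ i, ∑ j, (z i : ℂ) * (G i j * c) * (z j : ℂ)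
      = c * ∑ i, ∑ j, (z i : ℂ) * G i j * (z j : ℂ) := fun c G => by
    rw [← hc]
    simp only [mul_comm c]
  have hadd : ∀ G H : Fin d → Fin d → ℂ, ∑ i, ∑ j, (z i : ℂ) * (G i j + H i j) * (z j : ℂ)
      = ∑ i, ∑ j, (z i : ℂ) * G i j * (z j : ℂ) + ∑ i, ∑ j, (z i : ℂ) * H i j * (z j : ℂ) :=
    fun G H => by simp only [mul_add, add_mul, Finset.sum_add_distrib]
  simp only [diffusionAt]
  simp only [mul_sub, sub_mul, Finset.sum_sub_distrib]
  simp only [hq, hc, hlin, hs, hadd]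
  -- Both halves of the symmetrised entry give the same quadratic form, hence the factor `2`.
  have hswap : ∀ τ τ', reducedResolvent r μ C v (τ, τ) (τ', τ') *
      ((∑ i, (z i : ℂ) * r τ i) * ∑ i, (z i : ℂ) * r τ' i
        + ∑ i, ∑ j, (z i : ℂ) * ((r τ j : ℂ) * (r τ' i : ℂ)) * (z j : ℂ))
      = 2 * ((∑ i, (z i : ℂ) * r τ i) * (∑ i, (z i : ℂ) * r τ' i)
          * reducedResolvent r μ C v (τ, τ) (τ', τ')) := fun τ τ' => by
    have : ∑ i, ∑ j, (z i : ℂ) * ((r τ j : ℂ) * (r τ' i : ℂ)) * (z j : ℂ)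
        = (∑ i, (z i : ℂ) * r τ i) * ∑ i, (z i : ℂ) * r τ' i := by
      simp only [mul_comm (r τ _ : ℂ)]
      rw [hq, mul_comm]
    rw [this]
    ring
  simp only [hswap, ← Finset.mul_sum, pow_two]
  ring

/-- The value of the limiting second moment is the quadratic form of `𝔻(v)`. -/
lemma AssumptionS.limit_eq_diffusionAt [NeZero d] [IsProbabilityMeasure μ]
    (hS : AssumptionS r μ C) (hC : ∀ σ τ, Measurable fun ω =>
      (C ω : Matrix (CoinIdx d) (CoinIdx d) ℂ) σ τ) (v z : Fin d → ℝ) :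
    -traceForm d ((jumpOp r z ^ 2) (meanVec d))
        - 2 * traceForm d (jumpOp r z (shiftedInv r μ C v (jumpOp r z (meanVec d))))
      = ∑ i, ∑ j, (z i : ℂ) * diffusionAt r μ C v i j * (z j : ℂ) := by
  have hd : (2 * d : ℂ) ≠ 0 := mul_ne_zero two_ne_zero (by exact_mod_cast NeZero.ne d)
  have hred : ∀ τ τ', reducedResolvent r μ C v (τ, τ) (τ', τ')
      = (shiftedMat r μ C v)⁻¹ (τ, τ) (τ', τ') - (2 * d : ℂ)⁻¹ := fun τ τ' => by
    rw [reducedResolvent, Matrix.sub_apply, projP_apply]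
    simp [shiftedMat, psiOne]
  rw [sum_sum_diffusionAt]
  simp only [hred]
  rw [← centred_quadratic_identity hd (by rw [card_coinIdx]; push_cast; rfl) (sum_jump z)
    (hS.sum_row_shiftedMat_inv hC v) (hS.sum_col_shiftedMat_inv hC v)]
  congr 2
  · simp only [traceForm_apply, jumpOp_pow_apply, dotProduct_centred, meanVec_apply, if_true,
      mul_one, ← Finset.sum_mul]
    ring
  · rw [traceForm_apply, Finset.mul_sum]
    refine Finset.sum_congr rfl fun τ _ => ?_
    rw [jumpOp_apply, shiftedInv, toEuclideanCLM_apply_apply]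
    simp only [jumpOp_apply, ← mul_assoc]
    rw [sum_mul_meanVec]
    simp only [dotProduct_centred, Finset.mul_sum]
    exact Finset.sum_congr rfl fun τ' _ => by ring

/-- The inverse is the adjugate divided by a determinant that never vanishes. Continuity gives
integrability over the period. -/
lemma AssumptionS.continuous_diffusionAt [NeZero d] [IsProbabilityMeasure μ]
    (hS : AssumptionS r μ C) (hC : ∀ σ τ, Measurable fun ω =>
      (C ω : Matrix (CoinIdx d) (CoinIdx d) ℂ) σ τ) (i j : Fin d) :
    Continuous fun v => diffusionAt r μ C v i j := by
  have h1 : Continuous fun v : Fin d → ℝ => shiftedMat r μ C v :=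
    continuous_meanMat.sub continuous_const
  have h2 : Continuous fun v : Fin d → ℝ => (shiftedMat r μ C v)⁻¹ := by
    simp only [Matrix.inv_def, Ring.inverse_eq_inv']
    exact (h1.matrix_det.inv₀ (hS.det_shiftedMat_ne_zero hC)).smul h1.matrix_adjugate
  have h3 : ∀ S T, Continuous fun v : Fin d → ℝ => reducedResolvent r μ C v S T := fun S T =>
    (h2.sub continuous_const).matrix_elem S T
  unfold diffusionAt
  fun_prop

end Resolvent

/-! ### Finite range of the walk and conservation of probability. -/

section Evolution

variable {d : ℕ} {r : CoinIdx d → Fin d → ℤ}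

lemma step_apply (A : Matrix (CoinIdx d) (CoinIdx d) ℂ) (ψ : WaveFun d) (x : Fin d → ℤ)
    (τ : CoinIdx d) : step r A ψ x τ = ∑ σ, A τ σ * ψ (x - r τ) σ := by
  simp only [step, WithLp.ofLp_sum, Finset.sum_apply, EuclideanSpace.single]
  rw [Finset.sum_eq_single τ (fun σ _ hσ => by simp [hσ.symm]) (by simp)]
  simp [Matrix.mulVec, dotProduct]

lemma evolve_succ_apply (A : ℕ → Matrix (CoinIdx d) (CoinIdx d) ℂ) (ψ : WaveFun d) (n : ℕ)
    (x : Fin d → ℤ) (τ : CoinIdx d) :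
    evolve r A ψ (n + 1) x τ = ∑ σ, A n τ σ * evolve r A ψ n (x - r τ) σ :=
  step_apply _ _ _ _

/-- The range of the walk at time `n` lies in a finite set that does not depend on the coins. -/
lemma exists_finset_evolve_eq_zero (r : CoinIdx d → Fin d → ℤ) (φ : CoinSpace d) (n : ℕ) :
    ∃ s : Finset (Fin d → ℤ), ∀ (A : ℕ → Matrix (CoinIdx d) (CoinIdx d) ℂ), ∀ x ∉ s,
      evolve r A (localized φ) n x = 0 := by
  induction n with
  | zero =>
    refine ⟨{0}, fun A x hx => ?_⟩
    rw [Finset.mem_singleton] at hx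
    simp [evolve, localized, hx]
  | succ n ih =>
    obtain ⟨s, hs⟩ := ih
    refine ⟨(s ×ˢ Finset.univ).image fun p => p.1 + r p.2, fun A x hx => ?_⟩
    ext τ
    rw [evolve_succ_apply]
    have : x - r τ ∉ s := fun h => hx (Finset.mem_image.2 ⟨(x - r τ, τ), by simpa using h, by simp⟩)
    simp [hs A _ this]

/-- Conservation of probability. -/
lemma hasSum_posProb {A : ℕ → Matrix (CoinIdx d) (CoinIdx d) ℂ}
    (hA : ∀ n, A n ∈ Matrix.unitaryGroup (CoinIdx d) ℂ) {φ : CoinSpace d} (hφ : ‖φ‖ = 1) (n : ℕ) :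
    HasSum (posProb r A φ n) 1 := by
  induction n with
  | zero =>
    have h : posProb r A φ 0 = fun x => if x = 0 then 1 else 0 := by
      funext x
      by_cases hx : x = 0 <;> simp [posProb, evolve, localized, hx, hφ]
    rw [h]
    exact hasSum_ite_eq 0 1
  | succ n ih =>
    obtain ⟨s, hs⟩ := exists_finset_evolve_eq_zero r φ n
    set ψ := evolve r A (localized φ) n
    set g : CoinIdx d → (Fin d → ℤ) → ℝ := fun τ x => ‖∑ σ, A n τ σ * ψ x σ‖ ^ 2 with hg
    have h1 : ∀ τ, Summable (g τ) := fun τ =>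
      summable_of_ne_finset_zero (s := s) fun x hx => by simp [hg, ψ, hs A x hx]
    have h2 : ∀ x, posProb r A φ (n + 1) x = ∑ τ, g τ (x - r τ) := fun x => by
      rw [posProb, EuclideanSpace.norm_sq_eq]
      simp only [evolve_succ_apply]
      rfl
    -- The coin is unitary at each site; the shift then only translates each component `g τ`, which
    -- leaves its total mass unchanged.
    have h3 : ∀ x, ∑ τ, g τ x = posProb r A φ n x := fun x => by
      have := norm_toEuclideanCLM_of_unitary (hA n) (ψ x)
      rw [posProb, ← this, EuclideanSpace.norm_sq_eq]
      rfl
    have h4 : HasSum (fun x => ∑ τ, g τ (x - r τ)) (∑ τ, ∑' x, g τ x) :=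
      hasSum_sum fun τ _ => (Equiv.subRight (r τ)).hasSum_iff.2 (h1 τ).hasSum
    have h5 : HasSum (fun x => ∑ τ, g τ x) (∑ τ, ∑' x, g τ x) :=
      hasSum_sum fun τ _ => (h1 τ).hasSum
    rw [funext h3] at h5
    rw [funext h2, ih.unique h5]
    exact h4

lemma norm_evolve_apply_le {A : ℕ → Matrix (CoinIdx d) (CoinIdx d) ℂ}
    (hA : ∀ n, A n ∈ Matrix.unitaryGroup (CoinIdx d) ℂ) {φ : CoinSpace d} (hφ : ‖φ‖ = 1) (n : ℕ)
    (x : Fin d → ℤ) (τ : CoinIdx d) : ‖evolve r A (localized φ) n x τ‖ ≤ 1 := by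
  have h1 : ‖evolve r A (localized φ) n x‖ ^ 2 ≤ 1 :=
    le_hasSum (hasSum_posProb (r := r) hA hφ n) x fun y _ => sq_nonneg _
  have h2 := PiLp.norm_apply_le (evolve r A (localized φ) n x) τ
  nlinarith [norm_nonneg (evolve r A (localized φ) n x)]

end Evolution

/-! ### Independence of the coins and the two-point function. -/

section Correlation

variable {d : ℕ} {Ω : Type*} [MeasurableSpace Ω]
variable {r : CoinIdx d → Fin d → ℤ} {μ : Measure Ω} {C : Ω → Matrix.unitaryGroup (CoinIdx d) ℂ}

/-- The σ-algebra generated by the first `n` coins. -/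
abbrev pastAlgebra (Ω : Type*) [MeasurableSpace Ω] (n : ℕ) : MeasurableSpace (ℕ → Ω) :=
  ⨆ i ∈ Set.Iio n, MeasurableSpace.comap (fun ω : ℕ → Ω => ω i) inferInstance

lemma pastAlgebra_le (n : ℕ) : pastAlgebra Ω n ≤ MeasurableSpace.pi :=
  iSup₂_le fun i _ => (measurable_pi_apply i).comap_le

lemma pastAlgebra_mono {m n : ℕ} (h : m ≤ n) : pastAlgebra Ω m ≤ pastAlgebra Ω n :=
  biSup_mono fun _ hi => lt_of_lt_of_le hi h

lemma measurable_pastAlgebra_evolve (hC : ∀ σ τ, Measurable fun ω =>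
      (C ω : Matrix (CoinIdx d) (CoinIdx d) ℂ) σ τ) (φ : CoinSpace d) (n : ℕ) (x : Fin d → ℤ)
    (τ : CoinIdx d) :
    Measurable[pastAlgebra Ω n] fun ω => evolve r (coins C ω) (localized φ) n x τ := by
  induction n generalizing x τ with
  | zero =>
    exact (measurable_const : Measurable[pastAlgebra Ω 0] fun _ : ℕ → Ω => localized φ x τ)
  | succ n ih =>
    simp only [evolve_succ_apply]
    refine Finset.measurable_sum _ fun σ _ => Measurable.mul ?_ ?_
    · refine (hC τ σ).comp (Measurable.mono (comap_measurable fun ω : ℕ → Ω => ω n) ?_ le_rfl)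
      exact le_iSup₂_of_le n (Nat.lt_succ_self n) le_rfl
    · exact (ih (x - r τ) σ).mono (pastAlgebra_mono n.le_succ) le_rfl

lemma measurable_evolve (hC : ∀ σ τ, Measurable fun ω =>
      (C ω : Matrix (CoinIdx d) (CoinIdx d) ℂ) σ τ) (φ : CoinSpace d) (n : ℕ) (x : Fin d → ℤ)
    (τ : CoinIdx d) : Measurable fun ω => evolve r (coins C ω) (localized φ) n x τ :=
  (measurable_pastAlgebra_evolve hC φ n x τ).mono (pastAlgebra_le n) le_rfl

lemma indep_pastAlgebra [IsProbabilityMeasure μ] (n : ℕ) :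
    Indep (pastAlgebra Ω n) (MeasurableSpace.comap (fun ω : ℕ → Ω => ω n) inferInstance)
      (Measure.infinitePi fun _ : ℕ => μ) := by
  have h : iIndepFun (fun (i : ℕ) (ω : ℕ → Ω) => ω i) (Measure.infinitePi fun _ : ℕ => μ) :=
    iIndepFun_infinitePi (P := fun _ : ℕ => μ) (X := fun _ ω => ω) fun _ => measurable_id
  have h2 := indep_iSup_of_disjoint (fun i => (measurable_pi_apply i).comap_le) h
    (S := Set.Iio n) (T := {n}) (by simp)
  simpa only [Set.mem_singleton_iff, iSup_iSup_eq_left] using h2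

/-- `𝔼 (f (ω_0, …, ω_{n-1}) g (ω_n)) = 𝔼 f · 𝔼 g`. -/
lemma integral_past_mul [IsProbabilityMeasure μ] {n : ℕ} {f : (ℕ → Ω) → ℂ} {g : Ω → ℂ}
    (hf : Measurable[pastAlgebra Ω n] f) (hg : Measurable g) :
    ∫ ω : ℕ → Ω, g (ω n) * f ω ∂(Measure.infinitePi fun _ : ℕ => μ)
      = (∫ x, g x ∂μ) * ∫ ω, f ω ∂(Measure.infinitePi fun _ : ℕ => μ) := by
  have hgn : Measurable fun ω : ℕ → Ω => g (ω n) := hg.comp (measurable_pi_apply n)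
  have hi : IndepFun (fun ω : ℕ → Ω => g (ω n)) f (Measure.infinitePi fun _ : ℕ => μ) := by
    rw [IndepFun_iff_Indep]
    refine indep_of_indep_of_le_left (indep_of_indep_of_le_right (indep_pastAlgebra n).symm
      hf.comap_le) ?_
    rw [show (fun ω : ℕ → Ω => g (ω n)) = g ∘ fun ω => ω n from rfl, ← MeasurableSpace.comap_comp]
    exact MeasurableSpace.comap_mono hg.comap_le
  rw [hi.integral_fun_mul_eq_mul_integral hgn.aestronglyMeasurable
    (hf.mono (pastAlgebra_le n) le_rfl).aestronglyMeasurable]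
  congr 1
  have := Measure.infinitePi_map_eval (fun _ : ℕ => μ) n
  conv_rhs => rw [← this]
  rw [integral_map (measurable_pi_apply n).aemeasurable hg.aestronglyMeasurable]

/-- The two-point function `𝔼 (ψ_n(x) ⊗ \overline{ψ_n(x')})`. -/
noncomputable def twoPoint (r : CoinIdx d → Fin d → ℤ) (μ : Measure Ω)
    (C : Ω → Matrix.unitaryGroup (CoinIdx d) ℂ) (φ : CoinSpace d) (n : ℕ) (x x' : Fin d → ℤ)
    (T : CoinIdx d × CoinIdx d) : ℂ :=
  ∫ ω, evolve r (coins C ω) (localized φ) n x T.1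
    * (starRingEnd ℂ) (evolve r (coins C ω) (localized φ) n x' T.2)
    ∂(Measure.infinitePi fun _ : ℕ => μ)

lemma integrable_twoPoint [IsProbabilityMeasure μ] (hC : ∀ σ τ, Measurable fun ω =>
      (C ω : Matrix (CoinIdx d) (CoinIdx d) ℂ) σ τ) {φ : CoinSpace d} (hφ : ‖φ‖ = 1) (n : ℕ)
    (x x' : Fin d → ℤ) (T : CoinIdx d × CoinIdx d) :
    Integrable (fun ω => evolve r (coins C ω) (localized φ) n x T.1
      * (starRingEnd ℂ) (evolve r (coins C ω) (localized φ) n x' T.2))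
      (Measure.infinitePi fun _ : ℕ => μ) := by
  refine Integrable.of_bound (C := 1) ((measurable_evolve hC φ n x T.1).mul
    (Complex.continuous_conj.measurable.comp (measurable_evolve hC φ n x' T.2))).aestronglyMeasurable
    (ae_of_all _ fun ω => ?_)
  rw [norm_mul, RCLike.norm_conj]
  exact mul_le_one₀ (norm_evolve_apply_le (fun i => (C (ω i)).2) hφ _ _ _) (norm_nonneg _)
    (norm_evolve_apply_le (fun i => (C (ω i)).2) hφ _ _ _)

/-- The new amplitudes are bilinear in the entries of coin `n` and their conjugates, and that coin
is independent of `ψ_n`, so its average factors out as `ℰ`. -/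
lemma twoPoint_succ [IsProbabilityMeasure μ] (hC : ∀ σ τ, Measurable fun ω =>
      (C ω : Matrix (CoinIdx d) (CoinIdx d) ℂ) σ τ) {φ : CoinSpace d} (hφ : ‖φ‖ = 1) (n : ℕ)
    (x x' : Fin d → ℤ) (S : CoinIdx d × CoinIdx d) :
    twoPoint r μ C φ (n + 1) x x' S
      = ∑ T, meanTensor μ C S T * twoPoint r μ C φ n (x - r S.1) (x' - r S.2) T := by
  have h1 : ∀ ω : ℕ → Ω, evolve r (coins C ω) (localized φ) (n + 1) x S.1
      * (starRingEnd ℂ) (evolve r (coins C ω) (localized φ) (n + 1) x' S.2)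
      = ∑ T : CoinIdx d × CoinIdx d, ((C (ω n) : Matrix (CoinIdx d) (CoinIdx d) ℂ) ⊗ₖ
        (C (ω n) : Matrix (CoinIdx d) (CoinIdx d) ℂ).map (starRingEnd ℂ)) S T *
        (evolve r (coins C ω) (localized φ) n (x - r S.1) T.1
          * (starRingEnd ℂ) (evolve r (coins C ω) (localized φ) n (x' - r S.2) T.2)) := fun ω => by
    rw [evolve_succ_apply, evolve_succ_apply, map_sum, Finset.sum_mul_sum]
    conv_rhs => rw [Fintype.sum_prod_type]
    refine Finset.sum_congr rfl fun σ _ => ?_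
    refine Finset.sum_congr rfl fun σ' _ => ?_
    simp only [Matrix.kroneckerMap_apply, Matrix.map_apply, map_mul, coins]
    ring
  have hint : ∀ T, Integrable (fun ω : ℕ → Ω => ((C (ω n) : Matrix (CoinIdx d) (CoinIdx d) ℂ) ⊗ₖ
        (C (ω n) : Matrix (CoinIdx d) (CoinIdx d) ℂ).map (starRingEnd ℂ)) S T *
        (evolve r (coins C ω) (localized φ) n (x - r S.1) T.1
          * (starRingEnd ℂ) (evolve r (coins C ω) (localized φ) n (x' - r S.2) T.2)))
        (Measure.infinitePi fun _ : ℕ => μ) := fun T => by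
    refine (integrable_twoPoint hC hφ n _ _ T).bdd_mul (c := 1) ?_ (ae_of_all _ fun ω => ?_)
    · simp only [Matrix.kroneckerMap_apply, Matrix.map_apply]
      exact (((hC _ _).comp (measurable_pi_apply n)).mul (Complex.continuous_conj.measurable.comp
        ((hC _ _).comp (measurable_pi_apply n)))).aestronglyMeasurable
    · exact entry_norm_bound_of_unitary (tensor_mem_unitary (C (ω n))) S T
  rw [twoPoint]
  simp_rw [h1]
  rw [integral_finsetSum _ fun T _ => hint T]
  refine Finset.sum_congr rfl fun T _ => ?_
  refine integral_past_mul (g := fun ω => ((C ω : Matrix (CoinIdx d) (CoinIdx d) ℂ) ⊗ₖ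
        (C ω : Matrix (CoinIdx d) (CoinIdx d) ℂ).map (starRingEnd ℂ)) S T) ?_ ?_
  · exact (measurable_pastAlgebra_evolve hC φ n _ _).mul
      (Complex.continuous_conj.measurable.comp (measurable_pastAlgebra_evolve hC φ n _ _))
  · simp only [Matrix.kroneckerMap_apply, Matrix.map_apply]
    exact (hC _ _).mul (Complex.continuous_conj.measurable.comp (hC _ _))

end Correlation

/-! ### Moments in Fourier space. -/

section Moments

variable {d : ℕ} {Ω : Type*} [MeasurableSpace Ω]
variable {r : CoinIdx d → Fin d → ℤ} {μ : Measure Ω} {C : Ω → Matrix.unitaryGroup (CoinIdx d) ℂ}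

lemma exists_finset_twoPoint_eq_zero (r : CoinIdx d → Fin d → ℤ) (μ : Measure Ω)
    (C : Ω → Matrix.unitaryGroup (CoinIdx d) ℂ) (φ : CoinSpace d) (n : ℕ) :
    ∃ s : Finset (Fin d → ℤ), (∀ x ∉ s, ∀ ω : ℕ → Ω, posProb r (coins C ω) φ n x = 0) ∧
      (∀ x ∉ s, ∀ x' T, twoPoint r μ C φ n x x' T = 0) ∧
      ∀ p ∉ s ×ˢ s, ∀ T, twoPoint r μ C φ n p.1 p.2 T = 0 := by
  obtain ⟨s, hs⟩ := exists_finset_evolve_eq_zero r φ n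
  have h1 : ∀ x ∉ s, ∀ x' T, twoPoint r μ C φ n x x' T = 0 := fun x hx x' T => by
    simp [twoPoint, hs _ x hx]
  refine ⟨s, fun x hx ω => by simp [posProb, hs _ x hx], h1, fun p hp T => ?_⟩
  by_cases h : p.1 ∈ s
  · have h' : p.2 ∉ s := fun h' => hp (Finset.mem_product.2 ⟨h, h'⟩)
    simp [twoPoint, hs _ _ h']
  · exact h1 _ h _ _

/-- The character `exp (i v · (x' - x))`. -/
noncomputable def phase (v : Fin d → ℝ) (x x' : Fin d → ℤ) : ℂ :=
  Complex.exp (Complex.I * ((∑ i, ((-v) i * x i + v i * x' i) : ℝ) : ℂ))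

lemma phase_add (v : Fin d → ℝ) (x x' y y' : Fin d → ℤ) :
    phase v (x + y) (x' + y') = phase v x x' * phase v y y' := by
  rw [phase, phase, phase, ← Complex.exp_add, ← mul_add, ← Complex.ofReal_add,
    ← Finset.sum_add_distrib]
  congr 4
  funext i
  simp only [Pi.add_apply]
  push_cast
  ring

lemma phaseMat_apply_self (v : Fin d → ℝ) (S : CoinIdx d × CoinIdx d) :
    phaseMat r (-v) v S S = phase v (r S.1) (r S.2) := by
  rw [phaseMat, Matrix.diagonal_apply_eq, phase]

lemma continuous_phase (x x' : Fin d → ℤ) : Continuous fun v : Fin d → ℝ => phase v x x' := by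
  unfold phase
  simp only [Pi.neg_apply]
  fun_prop

/-- The component `z · (x - n r̄)` of the centred position. -/
noncomputable def displacement (r : CoinIdx d → Fin d → ℤ) (z : Fin d → ℝ) (n : ℕ)
    (x : Fin d → ℤ) : ℝ :=
  z ⬝ᵥ fun i => (x i - n * meanJump r i : ℝ)

lemma displacement_succ (z : Fin d → ℝ) (n : ℕ) (x : Fin d → ℤ) (τ : CoinIdx d) :
    displacement r z (n + 1) (x + r τ)
      = (z ⬝ᵥ fun i => (r τ i - meanJump r i : ℝ)) + displacement r z n x := by
  simp only [displacement, dotProduct, ← Finset.sum_add_distrib, Pi.add_apply]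
  refine Finset.sum_congr rfl fun i _ => ?_
  push_cast
  ring

/-- The Fourier transform at `(-v, v)` of the two-point function, weighted by the `m`-th power of
the displacement. -/
noncomputable def momentVec (r : CoinIdx d → Fin d → ℤ) (μ : Measure Ω)
    (C : Ω → Matrix.unitaryGroup (CoinIdx d) ℂ) (φ : CoinSpace d) (z v : Fin d → ℝ) (m n : ℕ) :
    TensorSpace d :=
  WithLp.toLp 2 fun S => ∑' p : (Fin d → ℤ) × (Fin d → ℤ),
    (displacement r z n p.1 : ℂ) ^ m * phase v p.1 p.2 * twoPoint r μ C φ n p.1 p.2 S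

lemma momentVec_apply (φ : CoinSpace d) (z v : Fin d → ℝ) (m n : ℕ) (S : CoinIdx d × CoinIdx d) :
    momentVec r μ C φ z v m n S = ∑' p : (Fin d → ℤ) × (Fin d → ℤ),
      (displacement r z n p.1 : ℂ) ^ m * phase v p.1 p.2 * twoPoint r μ C φ n p.1 p.2 S := rfl

/-- Translate the sum by the jumps `(r S.1, r S.2)`: the character factors and yields the phase
matrix, while the displacement splits as centred jump plus old displacement, so the binomial theorem
produces the hierarchy. -/
lemma isMomentSeq_momentVec [IsProbabilityMeasure μ] (hC : ∀ σ τ, Measurable fun ω =>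
      (C ω : Matrix (CoinIdx d) (CoinIdx d) ℂ) σ τ) {φ : CoinSpace d} (hφ : ‖φ‖ = 1)
    (z v : Fin d → ℝ) :
    IsMomentSeq (jumpOp r z) (meanOp r μ C v) (momentVec r μ C φ z v) := by
  intro m n
  ext S
  obtain ⟨s, -, -, hs⟩ := exists_finset_twoPoint_eq_zero r μ C φ n
  set a : ℂ := (((z ⬝ᵥ fun i => (r S.1 i - meanJump r i : ℝ)) : ℝ) : ℂ) with ha
  have hsum : ∀ (k : ℕ) (T : CoinIdx d × CoinIdx d), Summable
      fun p : (Fin d → ℤ) × (Fin d → ℤ) =>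
        (displacement r z n p.1 : ℂ) ^ k * phase v p.1 p.2 * twoPoint r μ C φ n p.1 p.2 T :=
    fun k T => summable_of_ne_finset_zero (s := s ×ˢ s) fun p hp => by simp [hs p hp]
  rw [momentVec_apply, ← (Equiv.addRight (r S.1, r S.2)).tsum_eq]
  have hterm : ∀ q : (Fin d → ℤ) × (Fin d → ℤ),
      (displacement r z (n + 1) (q.1 + r S.1) : ℂ) ^ m * phase v (q.1 + r S.1) (q.2 + r S.2)
        * twoPoint r μ C φ (n + 1) (q.1 + r S.1) (q.2 + r S.2) S
      = ∑ j ∈ Finset.range (m + 1), ∑ T, ((m.choose j : ℂ) * (a ^ j * meanMat r μ C (-v) v S T)) *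
        ((displacement r z n q.1 : ℂ) ^ (m - j) * phase v q.1 q.2
          * twoPoint r μ C φ n q.1 q.2 T) := fun q => by
    rw [displacement_succ, Complex.ofReal_add, ← ha, add_pow, phase_add, twoPoint_succ hC hφ,
      add_sub_cancel_right, add_sub_cancel_right, mul_assoc, Finset.sum_mul]
    refine Finset.sum_congr rfl fun j _ => ?_
    rw [Finset.mul_sum, Finset.mul_sum]
    refine Finset.sum_congr rfl fun T _ => ?_
    rw [meanMat_apply, phaseMat_apply_self]
    ring
  refine (tsum_congr hterm).trans ?_
  rw [Summable.tsum_finsetSum fun j _ => summable_sum fun T _ => (hsum _ T).mul_left _]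
  rw [WithLp.ofLp_sum, Finset.sum_apply]
  refine Finset.sum_congr rfl fun j _ => ?_
  rw [Summable.tsum_finsetSum fun T _ => (hsum _ T).mul_left _, PiLp.smul_apply, jumpOp_pow_apply,
    meanOp, toEuclideanCLM_apply_apply, ← ha, smul_eq_mul, Finset.mul_sum, Finset.mul_sum]
  refine Finset.sum_congr rfl fun T _ => ?_
  rw [tsum_mul_left, momentVec_apply]
  ring

lemma momentVec_zero [IsProbabilityMeasure μ] (φ : CoinSpace d) (z v : Fin d → ℝ) (m : ℕ)
    (S : CoinIdx d × CoinIdx d) :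
    momentVec r μ C φ z v m 0 S = (0 : ℂ) ^ m * (φ S.1 * (starRingEnd ℂ) (φ S.2)) := by
  rw [momentVec_apply, tsum_eq_single (0, 0)]
  · simp [displacement, phase, twoPoint, evolve, localized]
  · rintro ⟨x, x'⟩ h
    have : twoPoint r μ C φ 0 x x' S = 0 := by
      by_cases hx : x = 0
      · have hx' : x' ≠ 0 := fun h' => h (by rw [hx, h'])
        simp [twoPoint, evolve, localized, hx']
      · simp [twoPoint, evolve, localized, hx]
    simp [this]

lemma norm_momentVec_zero_le [IsProbabilityMeasure μ] (φ : CoinSpace d) (z v : Fin d → ℝ) (m : ℕ) :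
    ‖momentVec r μ C φ z v m 0‖
      ≤ ‖(WithLp.toLp 2 fun S : CoinIdx d × CoinIdx d => φ S.1 * (starRingEnd ℂ) (φ S.2) :
        TensorSpace d)‖ := by
  have h : momentVec r μ C φ z v m 0 = (0 : ℂ) ^ m •
      (WithLp.toLp 2 fun S : CoinIdx d × CoinIdx d => φ S.1 * (starRingEnd ℂ) (φ S.2) :
        TensorSpace d) := by
    ext S
    rw [momentVec_zero]
    rfl
  rw [h, norm_smul]
  refine mul_le_of_le_one_left (norm_nonneg _) ?_
  rw [norm_pow, norm_zero]
  exact pow_le_one₀ le_rfl zero_le_one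

lemma traceForm_momentVec_zero [IsProbabilityMeasure μ] {φ : CoinSpace d} (hφ : ‖φ‖ = 1)
    (z v : Fin d → ℝ) (m : ℕ) : traceForm d (momentVec r μ C φ z v m 0) = (0 : ℂ) ^ m := by
  have h : ∑ τ, φ τ * (starRingEnd ℂ) (φ τ) = 1 := by
    have h1 := EuclideanSpace.norm_sq_eq φ
    rw [hφ] at h1
    simp only [Complex.mul_conj, Complex.normSq_eq_norm_sq, ← Complex.ofReal_sum, ← h1]
    simp
  rw [traceForm_apply]
  simp only [momentVec_zero, ← Finset.mul_sum, h, mul_one]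

/-- One period of the momentum space. -/
def periodBox (d : ℕ) : Set (Fin d → ℝ) :=
  Set.univ.pi fun _ : Fin d => Set.Ico (0 : ℝ) (2 * Real.pi)

lemma periodBox_subset (d : ℕ) :
    periodBox d ⊆ Set.Icc (0 : Fin d → ℝ) (fun _ => 2 * Real.pi) := fun _ hv =>
  ⟨fun i => (hv i trivial).1, fun i => (hv i trivial).2.le⟩

lemma measurableSet_periodBox (d : ℕ) : MeasurableSet (periodBox d) :=
  MeasurableSet.univ_pi fun _ => measurableSet_Ico

lemma volume_periodBox_lt_top (d : ℕ) : volume (periodBox d) < ⊤ :=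
  (measure_mono (periodBox_subset d)).trans_lt isCompact_Icc.measure_lt_top

lemma integrableOn_periodBox {f : (Fin d → ℝ) → ℂ} (hf : Continuous f) :
    IntegrableOn f (periodBox d) :=
  (hf.continuousOn.integrableOn_compact isCompact_Icc).mono_set (periodBox_subset d)

lemma integral_exp_int (k : ℤ) :
    ∫ t in Set.Ico (0 : ℝ) (2 * Real.pi), Complex.exp (Complex.I * ((t * k : ℝ) : ℂ))
      = if k = 0 then (2 * Real.pi : ℂ) else 0 := by
  rw [integral_Ico_eq_integral_Ioc, ← intervalIntegral.integral_of_le Real.two_pi_pos.le]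
  split_ifs with hk
  · simp [hk]
  · have h : (Complex.I * k : ℂ) ≠ 0 := mul_ne_zero Complex.I_ne_zero (by exact_mod_cast hk)
    have h1 := integral_exp_mul_complex (a := 0) (b := 2 * Real.pi) h
    have h2 : ∀ t : ℝ, Complex.I * ((t * k : ℝ) : ℂ) = Complex.I * k * t := fun t => by
      push_cast; ring
    simp only [h2, h1]
    have h3 : Complex.exp (Complex.I * k * ((2 * Real.pi : ℝ) : ℂ)) = 1 := by
      rw [Complex.exp_eq_one_iff]
      exact ⟨k, by push_cast; ring⟩
    rw [h3]
    simp

/-- Orthogonality of characters. -/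
lemma integral_phase (x x' : Fin d → ℤ) :
    ∫ v in periodBox d, phase v x x' = if x = x' then (2 * Real.pi : ℂ) ^ d else 0 := by
  have h1 : ∀ v : Fin d → ℝ, phase v x x'
      = ∏ i, Complex.exp (Complex.I * ((v i * ((x' i - x i : ℤ) : ℝ) : ℝ) : ℂ)) := fun v => by
    rw [phase, ← Complex.exp_sum, ← Finset.mul_sum, ← Complex.ofReal_sum]
    congr 4
    funext i
    simp only [Pi.neg_apply]
    push_cast
    ring
  simp_rw [h1]
  rw [periodBox, volume_pi, Measure.restrict_pi_pi, integral_fintype_prod_eq_prod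
    (f := fun i t => Complex.exp (Complex.I * ((t * ((x' i - x i : ℤ) : ℝ) : ℝ) : ℂ)))]
  simp_rw [integral_exp_int]
  split_ifs with h
  · simp [h]
  · obtain ⟨i, hi⟩ := Function.ne_iff.1 h
    exact Finset.prod_eq_zero (Finset.mem_univ i) (if_neg (sub_ne_zero.2 (Ne.symm hi)))

/-- Integration over `v` kills the correlations with `x ≠ x'`; what remains on the diagonal are
averaged position probabilities. -/
lemma integral_traceForm_momentVec (φ : CoinSpace d) (z : Fin d → ℝ) (m n : ℕ) :
    ∫ v in periodBox d, traceForm d (momentVec r μ C φ z v m n)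
      = (2 * Real.pi : ℂ) ^ d * ∑' x, (displacement r z n x : ℂ) ^ m
        * ∑ τ, twoPoint r μ C φ n x x (τ, τ) := by
  obtain ⟨s, -, hs', hs⟩ := exists_finset_twoPoint_eq_zero r μ C φ n
  have h1 : ∀ v, traceForm d (momentVec r μ C φ z v m n)
      = ∑ τ, ∑ p ∈ s ×ˢ s, (displacement r z n p.1 : ℂ) ^ m * phase v p.1 p.2
        * twoPoint r μ C φ n p.1 p.2 (τ, τ) := fun v => by
    rw [traceForm_apply]
    refine Finset.sum_congr rfl fun τ _ => ?_
    rw [momentVec_apply]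
    exact tsum_eq_sum fun p hp => by simp [hs p hp]
  simp_rw [h1]
  have hint : ∀ (p : (Fin d → ℤ) × (Fin d → ℤ)) (τ : CoinIdx d), IntegrableOn
      (fun v => (displacement r z n p.1 : ℂ) ^ m * phase v p.1 p.2
        * twoPoint r μ C φ n p.1 p.2 (τ, τ)) (periodBox d) := fun p τ =>
    integrableOn_periodBox ((continuous_const.mul (continuous_phase _ _)).mul continuous_const)
  rw [integral_finsetSum _ fun τ _ => integrable_finsetSum _ fun p _ => hint p τ]
  simp_rw [integral_finsetSum _ fun p _ => hint p _, integral_mul_const, integral_const_mul,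
    integral_phase]
  rw [tsum_eq_sum (s := s) fun x hx => by simp [hs' x hx], Finset.mul_sum]
  simp_rw [Finset.mul_sum]
  rw [Finset.sum_comm (s := s)]
  refine Finset.sum_congr rfl fun τ _ => ?_
  rw [Finset.sum_product]
  refine Finset.sum_congr rfl fun x hx => ?_
  rw [Finset.sum_eq_single x (fun y _ hy => by simp [hy.symm]) (fun h => absurd hx h)]
  simp
  ring

/-- The averaged moments of the displacement. -/
noncomputable def moment (r : CoinIdx d → Fin d → ℤ) (μ : Measure Ω)
    (C : Ω → Matrix.unitaryGroup (CoinIdx d) ℂ) (φ : CoinSpace d) (z : Fin d → ℝ) (m n : ℕ) : ℝ :=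
  ∫ ω, ∑' x, posProb r (coins C ω) φ n x * displacement r z n x ^ m
    ∂(Measure.infinitePi fun _ : ℕ => μ)

lemma ofReal_moment [IsProbabilityMeasure μ] (hC : ∀ σ τ, Measurable fun ω =>
      (C ω : Matrix (CoinIdx d) (CoinIdx d) ℂ) σ τ) {φ : CoinSpace d} (hφ : ‖φ‖ = 1)
    (z : Fin d → ℝ) (m n : ℕ) :
    (moment r μ C φ z m n : ℂ) = ((2 * Real.pi : ℂ) ^ d)⁻¹ *
      ∫ v in periodBox d, traceForm d (momentVec r μ C φ z v m n) := by
  obtain ⟨s, hs0, hs', -⟩ := exists_finset_twoPoint_eq_zero r μ C φ n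
  have hpi : (2 * Real.pi : ℂ) ^ d ≠ 0 :=
    pow_ne_zero _ (mul_ne_zero two_ne_zero (by exact_mod_cast Real.pi_ne_zero))
  rw [integral_traceForm_momentVec, inv_mul_cancel_left₀ hpi, moment, ← integral_complex_ofReal]
  have h1 : ∀ ω : ℕ → Ω, ((∑' x, posProb r (coins C ω) φ n x * displacement r z n x ^ m : ℝ) : ℂ)
      = ∑ x ∈ s, (displacement r z n x : ℂ) ^ m * ∑ τ, evolve r (coins C ω) (localized φ) n x τ
        * (starRingEnd ℂ) (evolve r (coins C ω) (localized φ) n x τ) := fun ω => by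
    rw [tsum_eq_sum (s := s) fun x hx => by simp [hs0 x hx], Complex.ofReal_sum]
    refine Finset.sum_congr rfl fun x _ => ?_
    rw [posProb, EuclideanSpace.norm_sq_eq]
    simp only [Complex.mul_conj, Complex.normSq_eq_norm_sq]
    push_cast
    ring
  simp_rw [h1]
  rw [tsum_eq_sum (s := s) fun x hx => by simp [hs' x hx],
    integral_finsetSum _ fun x _ => (integrable_finsetSum _ fun τ _ =>
      integrable_twoPoint hC hφ n x x (τ, τ)).const_mul _]
  refine Finset.sum_congr rfl fun x _ => ?_
  rw [integral_const_mul, integral_finsetSum _ fun τ _ => integrable_twoPoint hC hφ n x x (τ, τ)]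
  rfl

end Moments

/-! ### Convergence of means from bounded second moments. -/

section UniformIntegrability

lemma integrable_comp_boundedContinuous {Ω : Type*} [MeasurableSpace Ω] {P : Measure Ω}
    [IsProbabilityMeasure P] (f : BoundedContinuousFunction ℝ ℝ) {Y : Ω → ℝ} (hY : AEMeasurable Y P) :
    Integrable (fun ω => f (Y ω)) P :=
  Integrable.of_bound (C := ‖f‖) (f.continuous.measurable.comp_aemeasurable hY).aestronglyMeasurable
    (ae_of_all _ fun _ => f.norm_coe_le_norm _)

lemma integrable_of_sq {Ω : Type*} [MeasurableSpace Ω] {P : Measure Ω}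
    [IsProbabilityMeasure P] {Y : Ω → ℝ} (hY : AEMeasurable Y P)
    (hY2 : Integrable (fun ω => Y ω ^ 2) P) : Integrable Y P :=
  ((memLp_two_iff_integrable_sq hY.aestronglyMeasurable).2 hY2).integrable (by norm_num)

/-- The truncation error of the mean is controlled by the second moment. -/
lemma abs_integral_sub_le {Ω : Type*} [MeasurableSpace Ω] {P : Measure Ω}
    [IsProbabilityMeasure P] {g : BoundedContinuousFunction ℝ ℝ} {L K : ℝ} (hL : 0 < L)
    (hg : ∀ x, |x - g x| ≤ x ^ 2 / L) {Y : Ω → ℝ} (hY : AEMeasurable Y P)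
    (hY2 : Integrable (fun ω => Y ω ^ 2) P) (hYK : ∫ ω, Y ω ^ 2 ∂P ≤ K) :
    |∫ ω, Y ω ∂P - ∫ ω, g (Y ω) ∂P| ≤ K / L := by
  have h1 := integrable_of_sq hY hY2
  have h2 := integrable_comp_boundedContinuous g hY
  rw [← integral_sub h1 h2]
  calc |∫ ω, (Y ω - g (Y ω)) ∂P| ≤ ∫ ω, |Y ω - g (Y ω)| ∂P := abs_integral_le_integral_abs
    _ ≤ ∫ ω, Y ω ^ 2 / L ∂P :=
        integral_mono (h1.sub h2).abs (hY2.div_const L) fun ω => hg _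
    _ = (∫ ω, Y ω ^ 2 ∂P) / L := integral_div _ _
    _ ≤ K / L := by gcongr

/-- Convergence in distribution with bounded second moments implies convergence of the means. -/
lemma tendsto_integral_of_tendstoInDistribution {Ω Ω' : Type*} [MeasurableSpace Ω]
    [MeasurableSpace Ω'] {P : Measure Ω} [IsProbabilityMeasure P] {ν : Measure Ω'}
    [IsProbabilityMeasure ν] {X : ℕ → Ω → ℝ} {Z : Ω' → ℝ}
    (h : TendstoInDistribution X atTop Z (fun _ => P) ν)
    (hX : ∀ n, Integrable (fun ω => X n ω ^ 2) P) {K : ℝ} (hK : ∀ n, ∫ ω, X n ω ^ 2 ∂P ≤ K) :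
    Integrable Z ν ∧ Tendsto (fun n => ∫ ω, X n ω ∂P) atTop (𝓝 (∫ ω', Z ω' ∂ν)) := by
  have hXm := h.forall_aemeasurable
  have hZm := h.aemeasurable_limit
  have hK0 : 0 ≤ K := (integral_nonneg fun ω => sq_nonneg _).trans (hK 0)
  have hbc : ∀ f : BoundedContinuousFunction ℝ ℝ,
      Tendsto (fun n => ∫ ω, f (X n ω) ∂P) atTop (𝓝 (∫ ω', f (Z ω') ∂ν)) := fun f => by
    have := (ProbabilityMeasure.tendsto_iff_forall_integral_tendsto.1 h.tendsto) f
    simp only [ProbabilityMeasure.coe_mk] at this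
    rw [integral_map hZm f.continuous.measurable.aestronglyMeasurable] at this
    refine this.congr fun n => ?_
    rw [integral_map (hXm n) f.continuous.measurable.aestronglyMeasurable]
  have hZ2 : Integrable (fun ω' => Z ω' ^ 2) ν ∧ ∫ ω', Z ω' ^ 2 ∂ν ≤ K := by
    -- Truncated squares are bounded continuous, so the bound `K` passes to them in the limit law;
    -- Fatou's lemma removes the truncation.
    set f : ℕ → BoundedContinuousFunction ℝ ℝ := fun L =>
      BoundedContinuousFunction.ofNormedAddCommGroup (fun x : ℝ => min (x ^ 2) (L : ℝ))
        (by fun_prop) L (fun x => by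
          rw [Real.norm_of_nonneg (le_min (sq_nonneg _) L.cast_nonneg)]
          exact min_le_right _ _) with hf
    have hfapp : ∀ L x, f L x = min (x ^ 2) (L : ℝ) := fun _ _ => rfl
    have hfK : ∀ L, ∫ ω', f L (Z ω') ∂ν ≤ K := fun L => by
      refine le_of_tendsto (hbc (f L)) (Eventually.of_forall fun n => ?_)
      exact (integral_mono (integrable_comp_boundedContinuous _ (hXm n)) (hX n) fun ω => min_le_left _ _).trans (hK n)
    have hlim : ∀ x : ℝ, Tendsto (fun L => ENNReal.ofReal (f L x)) atTop
        (𝓝 (ENNReal.ofReal (x ^ 2))) := fun x => by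
      refine tendsto_const_nhds.congr' ?_
      filter_upwards [eventually_ge_atTop ⌈x ^ 2⌉₊] with L hL
      rw [hfapp, min_eq_left (Nat.ceil_le.1 hL)]
    have hle : ∫⁻ ω', ENNReal.ofReal (Z ω' ^ 2) ∂ν ≤ ENNReal.ofReal K := by
      calc ∫⁻ ω', ENNReal.ofReal (Z ω' ^ 2) ∂ν
          = ∫⁻ ω', liminf (fun L => ENNReal.ofReal (f L (Z ω'))) atTop ∂ν :=
            lintegral_congr fun ω' => (hlim (Z ω')).liminf_eq.symm
        _ ≤ liminf (fun L => ∫⁻ ω', ENNReal.ofReal (f L (Z ω')) ∂ν) atTop :=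
            lintegral_liminf_le' fun L =>
              ((f L).continuous.measurable.comp_aemeasurable hZm).ennreal_ofReal
        _ ≤ ENNReal.ofReal K := by
            refine liminf_le_of_frequently_le' (Frequently.of_forall fun L => ?_)
            rw [← ofReal_integral_eq_lintegral_ofReal (integrable_comp_boundedContinuous _ hZm)
              (ae_of_all _ fun ω' => le_min (sq_nonneg _) L.cast_nonneg)]
            exact ENNReal.ofReal_le_ofReal (hfK L)
    have hm : AEStronglyMeasurable (fun ω' => Z ω' ^ 2) ν := (hZm.pow_const 2).aestronglyMeasurable
    have hi : Integrable (fun ω' => Z ω' ^ 2) ν := by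
      refine ⟨hm, ?_⟩
      rw [hasFiniteIntegral_iff_ofReal (ae_of_all _ fun ω' => sq_nonneg _)]
      exact hle.trans_lt ENNReal.ofReal_lt_top
    refine ⟨hi, ?_⟩
    rw [← ofReal_integral_eq_lintegral_ofReal hi (ae_of_all _ fun ω' => sq_nonneg _)] at hle
    exact (ENNReal.ofReal_le_ofReal_iff hK0).1 hle
  refine ⟨integrable_of_sq hZm hZ2.1, ?_⟩
  -- An `ε/3` argument with `g` the clamp to `[-L, L]`, whose error is at most `x²/L`. The `K + 1`
  -- in `L` keeps `L` positive when `K = 0`.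
  rw [Metric.tendsto_atTop]
  intro ε hε
  set L : ℝ := 3 * (K + 1) / ε with hL
  have hLpos : 0 < L := by positivity
  have hKL : K / L < ε / 3 := by
    rw [hL, div_div_eq_mul_div, div_lt_div_iff₀ (by positivity) (by norm_num)]
    nlinarith
  set g : BoundedContinuousFunction ℝ ℝ :=
    BoundedContinuousFunction.ofNormedAddCommGroup (fun x : ℝ => max (-L) (min x L))
      (by fun_prop) L (fun x => by
        rw [Real.norm_eq_abs, abs_le]
        exact ⟨le_max_left _ _, max_le (by linarith) (min_le_right _ _)⟩) with hg
  have hgx : ∀ x, |x - g x| ≤ x ^ 2 / L := fun x => by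
    change |x - max (-L) (min x L)| ≤ x ^ 2 / L
    rw [le_div_iff₀ hLpos]
    rcases le_total x L with h1 | h1
    · rw [min_eq_left h1]
      rcases le_total (-L) x with h2 | h2
      · rw [max_eq_right h2, sub_self, abs_zero, zero_mul]
        positivity
      · rw [max_eq_left h2, abs_of_nonpos (by linarith)]
        nlinarith
    · rw [min_eq_right h1, max_eq_right (by linarith), abs_of_nonneg (by linarith)]
      nlinarith
  obtain ⟨N, hN⟩ := Metric.tendsto_atTop.1 (hbc g) (ε / 3) (by positivity)
  refine ⟨N, fun n hn => ?_⟩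
  have h1 := abs_lt.1 ((abs_integral_sub_le hLpos hgx (hXm n) (hX n) (hK n)).trans_lt hKL)
  have h2 := abs_lt.1 ((abs_integral_sub_le hLpos hgx hZm hZ2.1 hZ2.2).trans_lt hKL)
  have h3 := hN n hn
  rw [Real.dist_eq, abs_lt] at h3 ⊢
  constructor <;> linarith [h1.1, h1.2, h2.1, h2.2, h3.1, h3.2]

end UniformIntegrability

/-! ### Moment bounds for the walk and the averaged diffusive limit. -/

section Diffusion

variable {d : ℕ} {Ω : Type*} [MeasurableSpace Ω]
variable {r : CoinIdx d → Fin d → ℤ} {μ : Measure Ω} {C : Ω → Matrix.unitaryGroup (CoinIdx d) ℂ}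

lemma AssumptionS.exists_moment_bound [NeZero d] [IsProbabilityMeasure μ]
    (hS : AssumptionS r μ C) (hC : ∀ σ τ, Measurable fun ω =>
      (C ω : Matrix (CoinIdx d) (CoinIdx d) ℂ) σ τ) {φ : CoinSpace d} (hφ : ‖φ‖ = 1)
    (z : Fin d → ℝ) :
    ∃ c : ℝ, ∀ v ∈ periodBox d, ∀ n : ℕ,
      ‖momentVec r μ C φ z v 0 n - traceForm d (momentVec r μ C φ z v 0 n) • meanVec d‖ ≤ c ∧
      ‖momentVec r μ C φ z v 1 n - traceForm d (momentVec r μ C φ z v 1 n) • meanVec d‖ ≤ c ∧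
      ‖traceForm d (momentVec r μ C φ z v 2 n)‖ ≤ c * ((n : ℝ) + 1) ∧
      ‖traceForm d (momentVec r μ C φ z v 4 n)‖ ≤ c * ((n : ℝ) + 1) ^ 2 := by
  obtain ⟨N, hN, hTN⟩ := hS.exists_uniform_contraction hC
    (isCompact_Icc (a := (0 : Fin d → ℝ)) (b := fun _ => 2 * Real.pi))
  obtain ⟨⟨c0, h0⟩, ⟨c1, h1⟩, ⟨c2, h2⟩, ⟨c4, h4⟩⟩ :=
    IsMomentSeq.growth (ι := periodBox d) (ℓ := traceForm d) (e := meanVec d) (A := jumpOp r z)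
      (M := fun v => meanOp r μ C v) (u := fun v => momentVec r μ C φ z v)
      traceForm_meanVec (fun v => meanOp_meanVec hC v) (fun v => traceForm_meanOp hC v)
      (traceForm_jumpOp_meanVec z) (fun v => norm_meanOp_le hC v) hN
      (fun v => hTN v (periodBox_subset d v.2)) (fun v => norm_deflate_meanOp_le hC v)
      (fun v => isMomentSeq_momentVec hC hφ z v) (fun v m => norm_momentVec_zero_le φ z v m)
  refine ⟨max (max c0 c1) (max c2 c4), fun v hv n => ⟨?_, ?_, ?_, ?_⟩⟩
  · exact ((h0 ⟨v, hv⟩ n).trans_eq (by simp)).trans ((le_max_left _ _).trans (le_max_left _ _))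
  · exact ((h1 ⟨v, hv⟩ n).trans_eq (by simp)).trans ((le_max_right _ _).trans (le_max_left _ _))
  · refine ((h2 ⟨v, hv⟩ n).trans_eq (by rw [pow_one])).trans ?_
    exact mul_le_mul_of_nonneg_right ((le_max_left _ _).trans (le_max_right _ _)) (by positivity)
  · refine (h4 ⟨v, hv⟩ n).trans ?_
    exact mul_le_mul_of_nonneg_right ((le_max_right _ _).trans (le_max_right _ _)) (by positivity)

lemma continuous_traceForm_momentVec (φ : CoinSpace d) (z : Fin d → ℝ) (m n : ℕ) :
    Continuous fun v => traceForm d (momentVec r μ C φ z v m n) := by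
  obtain ⟨s, -, -, hs⟩ := exists_finset_twoPoint_eq_zero r μ C φ n
  simp only [traceForm_apply]
  refine continuous_finsetSum _ fun τ _ => ?_
  have h : ∀ v, momentVec r μ C φ z v m n (τ, τ) = ∑ p ∈ s ×ˢ s,
      (displacement r z n p.1 : ℂ) ^ m * phase v p.1 p.2 * twoPoint r μ C φ n p.1 p.2 (τ, τ) :=
    fun v => by
      rw [momentVec_apply]
      exact tsum_eq_sum fun p hp => by simp [hs p hp]
  simp only [h]
  exact continuous_finsetSum _ fun p _ =>
    (continuous_const.mul (continuous_phase _ _)).mul continuous_const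

lemma AssumptionS.tendsto_moment_two [NeZero d] [IsProbabilityMeasure μ]
    (hS : AssumptionS r μ C) (hC : ∀ σ τ, Measurable fun ω =>
      (C ω : Matrix (CoinIdx d) (CoinIdx d) ℂ) σ τ) {φ : CoinSpace d} (hφ : ‖φ‖ = 1)
    (z : Fin d → ℝ) :
    Tendsto (fun n : ℕ => (((n : ℝ)⁻¹ * moment r μ C φ z 2 n : ℝ) : ℂ)) atTop
      (𝓝 (∑ i, ∑ j, (z i : ℂ) * diffusion r μ C i j * (z j : ℂ))) := by
  obtain ⟨c, hc⟩ := hS.exists_moment_bound hC hφ z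
  have hpt : ∀ v ∈ periodBox d, Tendsto
      (fun n : ℕ => (n : ℂ)⁻¹ * traceForm d (momentVec r μ C φ z v 2 n)) atTop
      (𝓝 (∑ i, ∑ j, (z i : ℂ) * diffusionAt r μ C v i j * (z j : ℂ))) := fun v hv => by
    obtain ⟨R, hR, hlim⟩ := exists_inverse_one_sub_deflate (A := jumpOp r z) traceForm_meanVec
      (meanOp_meanVec hC v) (traceForm_meanOp hC v) (traceForm_jumpOp_meanVec z)
      (hS.shiftedInv_apply hC v) (hS.apply_shiftedInv hC v)
    rw [← hS.limit_eq_diffusionAt hC v z, ← hlim]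
    exact (isMomentSeq_momentVec hC hφ z v).tendsto_second traceForm_meanVec (meanOp_meanVec hC v)
      (traceForm_meanOp hC v) (traceForm_jumpOp_meanVec z) hR
      (by rw [traceForm_momentVec_zero hφ, pow_zero])
      (by rw [traceForm_momentVec_zero hφ, zero_pow two_ne_zero])
      (fun n => (hc v hv n).1) (fun n => (hc v hv n).2.1)
  have hdom : Tendsto (fun n : ℕ => ∫ v in periodBox d,
      (n : ℂ)⁻¹ * traceForm d (momentVec r μ C φ z v 2 n)) atTop
      (𝓝 (∫ v in periodBox d, ∑ i, ∑ j, (z i : ℂ) * diffusionAt r μ C v i j * (z j : ℂ))) := by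
    -- The bound `2c` comes from `(n+1)/n ≤ 2`; at `n = 0` the integrand vanishes because `0⁻¹ = 0`.
    refine tendsto_integral_of_dominated_convergence (fun _ => 2 * c) (fun n => ?_) ?_
      (fun n => ?_) ?_
    · exact (continuous_const.mul
        (continuous_traceForm_momentVec φ z 2 n)).aestronglyMeasurable
    · exact integrableOn_const (volume_periodBox_lt_top d).ne
    · filter_upwards [ae_restrict_mem (measurableSet_periodBox d)] with v hv
      have hc0 : 0 ≤ c := (norm_nonneg _).trans (hc v hv 0).1
      rw [norm_mul, norm_inv, Complex.norm_natCast]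
      rcases Nat.eq_zero_or_pos n with rfl | hn
      · simpa using hc0
      · have hn' : (1 : ℝ) ≤ n := by exact_mod_cast hn
        rw [inv_mul_le_iff₀ (by positivity)]
        refine (hc v hv n).2.2.1.trans ?_
        nlinarith
    · filter_upwards [ae_restrict_mem (measurableSet_periodBox d)] with v hv using hpt v hv
  have hint : ∀ i j, IntegrableOn (fun v => (z i : ℂ) * diffusionAt r μ C v i j * (z j : ℂ))
      (periodBox d) := fun i j =>
    integrableOn_periodBox ((continuous_const.mul (hS.continuous_diffusionAt hC i j)).mul
      continuous_const)
  have hval : ((2 * Real.pi : ℂ) ^ d)⁻¹ *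
      ∫ v in periodBox d, ∑ i, ∑ j, (z i : ℂ) * diffusionAt r μ C v i j * (z j : ℂ)
      = ∑ i, ∑ j, (z i : ℂ) * diffusion r μ C i j * (z j : ℂ) := by
    rw [integral_finsetSum _ fun i _ => integrable_finsetSum _ fun j _ => hint i j, Finset.mul_sum]
    refine Finset.sum_congr rfl fun i _ => ?_
    rw [integral_finsetSum _ fun j _ => hint i j, Finset.mul_sum]
    refine Finset.sum_congr rfl fun j _ => ?_
    rw [integral_mul_const, integral_const_mul, diffusion, periodBox]
    ring
  rw [← hval]
  refine (hdom.const_mul _).congr fun n => ?_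
  rw [integral_const_mul, Complex.ofReal_mul, ofReal_moment hC hφ]
  push_cast
  ring

lemma AssumptionS.exists_moment_four_le [NeZero d] [IsProbabilityMeasure μ]
    (hS : AssumptionS r μ C) (hC : ∀ σ τ, Measurable fun ω =>
      (C ω : Matrix (CoinIdx d) (CoinIdx d) ℂ) σ τ) {φ : CoinSpace d} (hφ : ‖φ‖ = 1)
    (z : Fin d → ℝ) :
    ∃ c : ℝ, ∀ n : ℕ, moment r μ C φ z 4 n ≤ c * ((n : ℝ) + 1) ^ 2 := by
  obtain ⟨c, hc⟩ := hS.exists_moment_bound hC hφ z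
  refine ⟨‖((2 * Real.pi : ℂ) ^ d)⁻¹‖ * (c * volume.real (periodBox d)), fun n => ?_⟩
  refine (le_abs_self _).trans ?_
  rw [← Real.norm_eq_abs, ← Complex.norm_real, ofReal_moment hC hφ, norm_mul, mul_assoc]
  refine mul_le_mul_of_nonneg_left ?_ (norm_nonneg _)
  refine (norm_setIntegral_le_of_norm_le_const (volume_periodBox_lt_top d)
    fun v hv => (hc v hv n).2.2.2).trans_eq ?_
  ring

lemma quadForm_eq (A : ℕ → Matrix (CoinIdx d) (CoinIdx d) ℂ) (φ : CoinSpace d) (z : Fin d → ℝ)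
    (n : ℕ) : quadForm r A φ z n
      = (n : ℝ)⁻¹ * ∑' x, posProb r A φ n x * displacement r z n x ^ 2 := by
  rw [quadForm, ← tsum_mul_left]
  refine tsum_congr fun x => ?_
  have h : z ⬝ᵥ rescaled r n x = displacement r z n x / √(n : ℝ) := by
    simp only [displacement, dotProduct, rescaled, Finset.sum_div, mul_div_assoc]
  rw [dotProduct_comm (rescaled r n x) z, h, div_mul_div_comm, Real.mul_self_sqrt n.cast_nonneg]
  ring

/-- Cauchy–Schwarz for the probability weights `posProb`. -/
lemma sq_quadForm_le {A : ℕ → Matrix (CoinIdx d) (CoinIdx d) ℂ}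
    (hA : ∀ n, A n ∈ Matrix.unitaryGroup (CoinIdx d) ℂ) {φ : CoinSpace d} (hφ : ‖φ‖ = 1)
    (z : Fin d → ℝ) (n : ℕ) : quadForm r A φ z n ^ 2
      ≤ ((n : ℝ)⁻¹) ^ 2 * ∑' x, posProb r A φ n x * displacement r z n x ^ 4 := by
  obtain ⟨s, hs⟩ := exists_finset_evolve_eq_zero r φ n
  have h0 : ∀ x ∉ s, posProb r A φ n x = 0 := fun x hx => by simp [posProb, hs A x hx]
  rw [quadForm_eq, mul_pow, tsum_eq_sum (s := s) fun x hx => by simp [h0 x hx],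
    tsum_eq_sum (s := s) fun x hx => by simp [h0 x hx]]
  refine mul_le_mul_of_nonneg_left ?_ (sq_nonneg _)
  have hsum : ∑ x ∈ s, posProb r A φ n x = 1 :=
    (hasSum_sum_of_ne_finset_zero h0).unique (hasSum_posProb hA hφ n)
  have hp : ∀ x, 0 ≤ posProb r A φ n x := fun x => sq_nonneg _
  have := Finset.sum_sq_le_sum_mul_sum_of_sq_le_mul s (r := fun x =>
    posProb r A φ n x * displacement r z n x ^ 2) (f := fun x => posProb r A φ n x)
    (g := fun x => posProb r A φ n x * displacement r z n x ^ 4) (fun x _ => hp x)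
    (fun x _ => mul_nonneg (hp x) (by positivity)) (fun x _ => le_of_eq (by ring))
  rwa [hsum, one_mul] at this

lemma measurable_posProb (hC : ∀ σ τ, Measurable fun ω =>
      (C ω : Matrix (CoinIdx d) (CoinIdx d) ℂ) σ τ) (φ : CoinSpace d) (n : ℕ) (x : Fin d → ℤ) :
    Measurable fun ω => posProb r (coins C ω) φ n x := by
  simp only [posProb, EuclideanSpace.norm_sq_eq]
  exact Finset.measurable_sum _ fun τ _ => (measurable_evolve hC φ n x τ).norm.pow_const 2

lemma integrable_weighted_posProb [IsProbabilityMeasure μ] (hC : ∀ σ τ, Measurable fun ω =>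
      (C ω : Matrix (CoinIdx d) (CoinIdx d) ℂ) σ τ) {φ : CoinSpace d} (hφ : ‖φ‖ = 1) (n : ℕ)
    (w : (Fin d → ℤ) → ℝ) :
    Integrable (fun ω => ∑' x, posProb r (coins C ω) φ n x * w x)
      (Measure.infinitePi fun _ : ℕ => μ) := by
  obtain ⟨s, hs, -⟩ := exists_finset_twoPoint_eq_zero r μ C φ n
  have h : ∀ ω : ℕ → Ω, ∑' x, posProb r (coins C ω) φ n x * w x
      = ∑ x ∈ s, posProb r (coins C ω) φ n x * w x := fun ω =>
    tsum_eq_sum fun x hx => by simp [hs x hx]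
  simp only [h]
  refine integrable_finsetSum _ fun x _ => Integrable.mul_const ?_ _
  refine Integrable.of_bound (C := 1) (measurable_posProb hC φ n x).aestronglyMeasurable
    (ae_of_all _ fun ω => ?_)
  rw [Real.norm_of_nonneg (show 0 ≤ posProb r (coins C ω) φ n x from sq_nonneg _)]
  exact le_hasSum (hasSum_posProb (fun i => (C (ω i)).2) hφ n) x fun y _ => sq_nonneg _

lemma integrable_quadForm [IsProbabilityMeasure μ] (hC : ∀ σ τ, Measurable fun ω =>
      (C ω : Matrix (CoinIdx d) (CoinIdx d) ℂ) σ τ) {φ : CoinSpace d} (hφ : ‖φ‖ = 1)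
    (z : Fin d → ℝ) (n : ℕ) :
    Integrable (fun ω => quadForm r (coins C ω) φ z n) (Measure.infinitePi fun _ : ℕ => μ) := by
  simp only [quadForm_eq]
  exact (integrable_weighted_posProb hC hφ n _).const_mul _

lemma integral_quadForm (φ : CoinSpace d) (z : Fin d → ℝ) (n : ℕ) [IsProbabilityMeasure μ] :
    ∫ ω, quadForm r (coins C ω) φ z n ∂(Measure.infinitePi fun _ : ℕ => μ)
      = (n : ℝ)⁻¹ * moment r μ C φ z 2 n := by
  simp only [quadForm_eq, integral_const_mul, moment]

/-- The fourth moment is `O(n²)`, exactly compensated by the factor `n⁻²`; this supplies the uniform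
integrability. -/
lemma AssumptionS.exists_sq_quadForm_bound [NeZero d] [IsProbabilityMeasure μ]
    (hS : AssumptionS r μ C) (hC : ∀ σ τ, Measurable fun ω =>
      (C ω : Matrix (CoinIdx d) (CoinIdx d) ℂ) σ τ) {φ : CoinSpace d} (hφ : ‖φ‖ = 1)
    (z : Fin d → ℝ) :
    (∀ n, Integrable (fun ω => quadForm r (coins C ω) φ z n ^ 2)
      (Measure.infinitePi fun _ : ℕ => μ)) ∧
    ∃ K : ℝ, ∀ n, ∫ ω, quadForm r (coins C ω) φ z n ^ 2 ∂(Measure.infinitePi fun _ : ℕ => μ)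
      ≤ K := by
  have hle : ∀ (n : ℕ) (ω : ℕ → Ω), quadForm r (coins C ω) φ z n ^ 2 ≤ ((n : ℝ)⁻¹) ^ 2 *
      ∑' x, posProb r (coins C ω) φ n x * displacement r z n x ^ 4 := fun n ω =>
    sq_quadForm_le (fun i => (C (ω i)).2) hφ z n
  have hi4 := fun n : ℕ => (integrable_weighted_posProb (r := r) hC hφ n
    (fun x => displacement r z n x ^ 4)).const_mul (((n : ℝ)⁻¹) ^ 2) (μ :=
      Measure.infinitePi fun _ : ℕ => μ)
  have hi : ∀ n, Integrable (fun ω => quadForm r (coins C ω) φ z n ^ 2)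
      (Measure.infinitePi fun _ : ℕ => μ) := fun n => by
    refine (hi4 n).mono' ((integrable_quadForm hC hφ z n).1.pow 2) (ae_of_all _ fun ω => ?_)
    rw [Real.norm_of_nonneg (sq_nonneg _)]
    exact hle n ω
  refine ⟨hi, ?_⟩
  obtain ⟨c, hc⟩ := hS.exists_moment_four_le hC hφ z
  refine ⟨4 * |c|, fun n => ?_⟩
  refine (integral_mono (hi n) (hi4 n) (hle n)).trans ?_
  rw [integral_const_mul]
  change ((n : ℝ)⁻¹) ^ 2 * moment r μ C φ z 4 n ≤ _
  rcases Nat.eq_zero_or_pos n with rfl | hn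
  · simp
  · have hn' : (1 : ℝ) ≤ n := by exact_mod_cast hn
    rw [inv_pow, inv_mul_le_iff₀ (by positivity)]
    refine ((hc n).trans (mul_le_mul_of_nonneg_right (le_abs_self c) (by positivity))).trans ?_
    have : ((n : ℝ) + 1) ^ 2 ≤ 4 * (n : ℝ) ^ 2 := by nlinarith
    nlinarith [mul_le_mul_of_nonneg_left this (abs_nonneg c)]

lemma diffusion_symm (r : CoinIdx d → Fin d → ℤ) (μ : Measure Ω)
    (C : Ω → Matrix.unitaryGroup (CoinIdx d) ℂ) (i j : Fin d) :
    diffusion r μ C i j = diffusion r μ C j i := by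
  have h : ∀ v, diffusionAt r μ C v i j = diffusionAt r μ C v j i := fun v => by
    simp only [diffusionAt]
    congr 2
    · ring
    · simp only [mul_comm (r _ i : ℂ)]
    · refine Finset.sum_congr rfl fun τ _ => ?_
      refine Finset.sum_congr rfl fun τ' _ => ?_
      rw [add_comm]
  simp only [diffusion, h]

lemma sum_sum_single_add_single {R : Type*} [CommSemiring R] (B : Matrix (Fin d) (Fin d) R)
    (i j : Fin d) (y : Fin d → R) (hy : ∀ k, y k = (if k = i then 1 else 0) + if k = j then 1 else 0) :
    ∑ a, ∑ b, y a * B a b * y b = B i i + B i j + B j i + B j j := by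
  simp only [hy, add_mul, mul_add, Finset.sum_add_distrib, ite_mul, mul_ite, one_mul, mul_one,
    zero_mul, mul_zero, Finset.sum_ite_eq', Finset.mem_univ, if_true]
  ring

lemma sum_sum_single {R : Type*} [CommSemiring R] (B : Matrix (Fin d) (Fin d) R)
    (i : Fin d) (y : Fin d → R) (hy : ∀ k, y k = if k = i then 1 else 0) :
    ∑ a, ∑ b, y a * B a b * y b = B i i := by
  simp [hy]

end Diffusion

end RandomQuantumWalk

theorem mainTheorem9
    (d : ℕ) (r : RandomQuantumWalk.CoinIdx d → Fin d → ℤ)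
    {Ω : Type*} [MeasurableSpace Ω] (μ : Measure Ω) [IsProbabilityMeasure μ]
    (C : Ω → Matrix.unitaryGroup (RandomQuantumWalk.CoinIdx d) ℂ)
    (hC : ∀ σ τ, Measurable fun ω =>
      (C ω : Matrix (RandomQuantumWalk.CoinIdx d) (RandomQuantumWalk.CoinIdx d) ℂ) σ τ)
    (φ₀ : RandomQuantumWalk.CoinSpace d) (hφ₀ : ‖φ₀‖ = 1)
    (hS : RandomQuantumWalk.AssumptionS r μ C)
    {Ω' : Type*} [MeasurableSpace Ω'] (ν : Measure Ω') [IsProbabilityMeasure ν] :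
    -- a fixed direction `z` and a limit `D^ω` in distribution
    (∀ z : Fin d → ℝ, z ≠ 0 → ∀ Dlim : Ω' → ℝ,
      TendstoInDistribution
        (fun (n : ℕ) (ω : ℕ → Ω) =>
          RandomQuantumWalk.quadForm r (RandomQuantumWalk.coins C ω) φ₀ z n)
        atTop Dlim (fun _ => Measure.infinitePi fun _ : ℕ => μ) ν →
      (∀ n : ℕ, Integrable
        (fun ω : ℕ → Ω => RandomQuantumWalk.quadForm r (RandomQuantumWalk.coins C ω) φ₀ z n)
        (Measure.infinitePi fun _ : ℕ => μ)) ∧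
      Integrable Dlim ν ∧
      Tendsto
        (fun n : ℕ => ∫ ω : ℕ → Ω,
          RandomQuantumWalk.quadForm r (RandomQuantumWalk.coins C ω) φ₀ z n
            ∂(Measure.infinitePi fun _ : ℕ => μ))
        atTop (𝓝 (∫ ω', Dlim ω' ∂ν)) ∧
      ((∫ ω', Dlim ω' ∂ν : ℝ) : ℂ)
        = ∑ i, ∑ j, (z i : ℂ) * RandomQuantumWalk.diffusion r μ C i j * (z j : ℂ)) ∧
    -- a random symmetric matrix `𝔻^ω` giving the limits in all directions
    (∀ Dmat : Ω' → Matrix (Fin d) (Fin d) ℝ, (∀ᵐ ω' ∂ν, (Dmat ω').IsSymm) →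
      (∀ z : Fin d → ℝ, z ≠ 0 →
        TendstoInDistribution
          (fun (n : ℕ) (ω : ℕ → Ω) =>
            RandomQuantumWalk.quadForm r (RandomQuantumWalk.coins C ω) φ₀ z n)
          atTop (fun ω' => z ⬝ᵥ (Dmat ω').mulVec z)
          (fun _ => Measure.infinitePi fun _ : ℕ => μ) ν) →
      ∀ i j, Integrable (fun ω' => Dmat ω' i j) ν ∧
        ((∫ ω', Dmat ω' i j ∂ν : ℝ) : ℂ) = RandomQuantumWalk.diffusion r μ C i j) := by
  -- For `d = 0` the coin space is trivial and contains no unit vector.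
  have : NeZero d := ⟨by
    rintro rfl
    have : φ₀ = 0 := Subsingleton.elim _ _
    simp [this] at hφ₀⟩
  have main : ∀ z : Fin d → ℝ, z ≠ 0 → ∀ Dlim : Ω' → ℝ,
      TendstoInDistribution
        (fun (n : ℕ) (ω : ℕ → Ω) =>
          RandomQuantumWalk.quadForm r (RandomQuantumWalk.coins C ω) φ₀ z n)
        atTop Dlim (fun _ => Measure.infinitePi fun _ : ℕ => μ) ν →
      (∀ n : ℕ, Integrable
        (fun ω : ℕ → Ω => RandomQuantumWalk.quadForm r (RandomQuantumWalk.coins C ω) φ₀ z n)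
        (Measure.infinitePi fun _ : ℕ => μ)) ∧
      Integrable Dlim ν ∧
      Tendsto
        (fun n : ℕ => ∫ ω : ℕ → Ω,
          RandomQuantumWalk.quadForm r (RandomQuantumWalk.coins C ω) φ₀ z n
            ∂(Measure.infinitePi fun _ : ℕ => μ))
        atTop (𝓝 (∫ ω', Dlim ω' ∂ν)) ∧
      ((∫ ω', Dlim ω' ∂ν : ℝ) : ℂ)
        = ∑ i, ∑ j, (z i : ℂ) * RandomQuantumWalk.diffusion r μ C i j * (z j : ℂ) := by
    intro z _ Dlim hD
    obtain ⟨hi, K, hK⟩ := hS.exists_sq_quadForm_bound hC hφ₀ z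
    obtain ⟨h1, h2⟩ := RandomQuantumWalk.tendsto_integral_of_tendstoInDistribution hD hi hK
    refine ⟨RandomQuantumWalk.integrable_quadForm hC hφ₀ z, h1, h2, ?_⟩
    refine tendsto_nhds_unique ((Complex.continuous_ofReal.tendsto _).comp h2) ?_
    refine (hS.tendsto_moment_two hC hφ₀ z).congr fun n => ?_
    rw [Function.comp_apply, RandomQuantumWalk.integral_quadForm]
  refine ⟨main, fun Dmat hsymm hD i j => ?_⟩
  have hq : ∀ z : Fin d → ℝ, z ≠ 0 →
      Integrable (fun ω' => ∑ a, ∑ b, z a * Dmat ω' a b * z b) ν ∧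
      ((∫ ω', ∑ a, ∑ b, z a * Dmat ω' a b * z b ∂ν : ℝ) : ℂ)
        = ∑ a, ∑ b, (z a : ℂ) * RandomQuantumWalk.diffusion r μ C a b * (z b : ℂ) := fun z hz => by
    obtain ⟨-, h1, -, h2⟩ := main z hz _ (hD z hz)
    have h : ∀ ω', z ⬝ᵥ (Dmat ω').mulVec z = ∑ a, ∑ b, z a * Dmat ω' a b * z b := fun ω' => by
      simp only [dotProduct, Matrix.mulVec, Finset.mul_sum, mul_assoc]
    simp only [h] at h1 h2
    exact ⟨h1, h2⟩
  have hdiag : ∀ k, Integrable (fun ω' => Dmat ω' k k) ν ∧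
      ((∫ ω', Dmat ω' k k ∂ν : ℝ) : ℂ) = RandomQuantumWalk.diffusion r μ C k k := fun k => by
    obtain ⟨h1, h2⟩ := hq (fun a => if a = k then 1 else 0)
      (fun h => by simpa using congrFun h k)
    simp only [RandomQuantumWalk.sum_sum_single _ k _ fun _ => rfl] at h1 h2
    rw [RandomQuantumWalk.sum_sum_single _ k _ fun a => by split_ifs <;> simp] at h2
    exact ⟨h1, h2⟩
  -- Polarization with `z = e_i + e_j`; when `i = j` this is `2 e_i`, still nonzero, and the same
  -- formula holds.
  obtain ⟨h1, h2⟩ := hq (fun a => (if a = i then 1 else 0) + if a = j then 1 else 0) (fun h => by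
    have := congrFun h i
    simp only [if_true, Pi.zero_apply] at this
    split_ifs at this <;> norm_num at this)
  simp only [RandomQuantumWalk.sum_sum_single_add_single _ i j _ fun _ => rfl] at h1 h2
  rw [RandomQuantumWalk.sum_sum_single_add_single _ i j _ fun a => by
    split_ifs <;> simp, RandomQuantumWalk.diffusion_symm r μ C j i] at h2
  have hae : (fun ω' => (Dmat ω' i i + Dmat ω' i j + Dmat ω' j i + Dmat ω' j j
      - Dmat ω' i i - Dmat ω' j j) / 2) =ᵐ[ν] fun ω' => Dmat ω' i j := by
    filter_upwards [hsymm] with ω' h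
    rw [h.apply i j]
    ring
  refine ⟨(((h1.sub (hdiag i).1).sub (hdiag j).1).div_const 2).congr hae, ?_⟩
  have e1 := integral_sub (h1.sub (hdiag i).1) (hdiag j).1
  have e2 := integral_sub h1 (hdiag i).1
  simp only [Pi.sub_apply] at e1
  rw [← integral_congr_ae hae, integral_div, e1, e2]
  push_cast
  rw [h2, (hdiag i).2, (hdiag j).2]
  ring
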